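/- Consider, for unit vector fields $m(x,t)\in\mathbb S^2$, $x,t\in\mathbb R$, the axially symmetric Landau--Lifschitz--Gilbert--Slonczewski equation $$\partial_t m-\alpha\, m\times\partial_t m=-m\times\bigl(\partial_x^2 m+h\,e_3-\mu\, m_3\,e_3\bigr)+m\times\Bigl(m\times\frac{\beta}{1+c_{\rm cp}m_3}\,e_3\Bigr),$$ with $\alpha>0$, $\beta\ge 0$, $h\in\mathbb R$, $\mu<0$, $c_{\rm cp}\in(-1,1)$. A *domain wall* with speed $s$ and frequency $\Omega$ is a classical solution of the form $$m=(\cos\varphi\sin\theta,\ \sin\varphi\sin\theta,\ \cos\theta),\qquad \theta=\theta(\xi)\in(0,\pi),\quad \varphi=\phi(\xi)+\Omega t,\quad \xi=x-st,$$ with $\theta,\phi\in C^2(\mathbb R)$, which connects the poles $\pm e_3$: either $\theta\to0$ as $\xi\to-\infty$ and $\theta\to\pi$ as $\xi\to+\infty$, or the reverse. Put $q=\phi'$ and $p=\theta'/\sin\theta$. The wall is *homogeneous* if $q\equiv0$ and *inhomogeneous* otherwise; it is *flat* if $|q(\xi)|$ has a limit in $\mathbb R\cup\{\infty\}$ as $\xi\to-\infty$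 and as $\xi\to+\infty$ (the two limits may differ). Let $$s_0(\alpha,\beta,h,\mu)=\frac{\alpha h-\beta}{\sqrt{-\mu}\,(1+\alpha^2)},\qquad \Omega_0(\alpha,\beta,h)=\frac{h+\alpha\beta}{1+\alpha^2}.$$ **Theorem.** Let $\alpha_0>0$, $\beta_0\ge0$, $\mu_0<0$ and $h_0>\beta_0/\alpha_0-2\mu_0-2\mu_0/\alpha_0^2$ (the codim-0 case), and let $$P_0=\bigl(0,\alpha_0,\beta_0,h_0,\mu_0,s_0(\alpha_0,\beta_0,h_0,\mu_0),\Omega_0(\alpha_0,\beta_0,h_0)\bigr)\in\mathbb R^7.$$ Then there are an open neighborhood $U$ of $P_0$, contained in $\{|c_{\rm cp}|<1,\ \alpha>0,\ \mu<0\}$, and a family $(\theta_P,\phi_P)$, $P=(c_{\rm cp},\alpha,\beta,h,\mu,s,\Omega)\in U$, such that: 1. for every $P\in U$, $(\theta_P,\phi_P)$ is a flat domain wall for the parameters $P$; 2. $(P,\xi)\mapsto(\theta_P(\xi),\phi_P(\xi))$ is $C^\infty$ on $U\times\mathbb R$; 3. at $P=P_0$ it is the explicit homogeneous wall $m_0$: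 $\theta_{P_0}(\xi)=2\arctan\bigl(e^{\sqrt{-\mu_0}\,\xi}\bigr)$, $\phi_{P_0}\equiv0$; and $(\theta_P,p_P,q_P)\to(\theta_{P_0},p_{P_0},q_{P_0})$ uniformly on $\mathbb R$ as $P\to P_0$; 4. (local uniqueness) there is $\varepsilon>0$ such that, for every $P\in U$, each domain wall $(\theta,\phi)$ for the parameters $P$ whose curve $(\theta,p,q)$ stays within distance $\varepsilon$ of the curve $\{(\theta_{P_0},p_{P_0},q_{P_0})(\eta):\eta\in\mathbb R\}$ is of the form $\theta(\xi)=\theta_P(\xi+a)$, $\phi(\xi)=\phi_P(\xi+a)+b$ with constants $a,b\in\mathbb R$; 5. for every $P\in U$ such that $\beta\, c_{\rm cp}\neq0$ or $(s,\Omega)\neq\bigl(s_0(\alpha,\beta,h,\mu),\Omega_0(\alpha,\beta,h)\bigr)$, the wall $(\theta_P,\phi_P)$ is inhomogeneous. -/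

import Mathlib

open Set Filter Topology
open scoped Matrix ContDiff

noncomputable section

namespace LLGS

/-- The parameter space, with coordinates `(c, α, β, h, μ, s, Ω)`: polarization ratio, Gilbert
damping, spin-transfer strength, applied field, anisotropy, speed and frequency. -/
abbrev Param : Type := ℝ × ℝ × ℝ × ℝ × ℝ × ℝ × ℝ

/-- The unit vector `e₃`. -/
def e3 : Fin 3 → ℝ := ![0, 0, 1]

/-- The effective field `∂ₓ² m + h e₃ - μ m₃ e₃` of `m = m(x, t)`. -/
def effectiveField (h μ : ℝ) (m : ℝ → ℝ → Fin 3 → ℝ) (x t : ℝ) : Fin 3 → ℝ :=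
  deriv (fun y => deriv (fun z => m z t) y) x + h • e3 - (μ * m x t 2) • e3

/-- The polarized current term `J = β / (1 + c m₃) e₃`. -/
def currentTerm (c β : ℝ) (v : Fin 3 → ℝ) : Fin 3 → ℝ :=
  (β / (1 + c * v 2)) • e3

/-- `m = m(x, t)` is a classical solution of the Landau-Lifschitz-Gilbert-Slonczewski equation
`∂ₜ m - α m × ∂ₜ m = - m × h_eff + m × (m × J)` with values in the unit sphere. -/
structure IsSolution (c α β h μ : ℝ) (m : ℝ → ℝ → Fin 3 → ℝ) : Prop where
  contDiff : ContDiff ℝ 2 (fun z : ℝ × ℝ => m z.1 z.2)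
  unit : ∀ x t, m x t ⬝ᵥ m x t = 1
  eqn : ∀ x t,
    deriv (fun τ => m x τ) t - α • (m x t ⨯₃ deriv (fun τ => m x τ) t) =
      -(m x t ⨯₃ effectiveField h μ m x t) + m x t ⨯₃ (m x t ⨯₃ currentTerm c β (m x t))

/-- The magnetization with polar angle `θ(ξ)` and azimuthal angle `φ(ξ) + Ω t`, `ξ = x - s t`. -/
def magnetization (s Ω : ℝ) (θ φ : ℝ → ℝ) (x t : ℝ) : Fin 3 → ℝ :=
  ![Real.cos (φ (x - s * t) + Ω * t) * Real.sin (θ (x - s * t)),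
    Real.sin (φ (x - s * t) + Ω * t) * Real.sin (θ (x - s * t)),
    Real.cos (θ (x - s * t))]

/-- The profile `(θ, φ)` is a domain wall with speed `s` and frequency `Ω`: the corresponding
magnetization solves the equation and connects the two poles `± e₃` (in either order). -/
structure IsDomainWall (c α β h μ s Ω : ℝ) (θ φ : ℝ → ℝ) : Prop where
  contDiff_polar : ContDiff ℝ 2 θ
  contDiff_azimuth : ContDiff ℝ 2 φ
  polar_mem : ∀ ξ, θ ξ ∈ Ioo 0 Real.pi
  connects : (Tendsto θ atBot (𝓝 0) ∧ Tendsto θ atTop (𝓝 Real.pi)) ∨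
    (Tendsto θ atBot (𝓝 Real.pi) ∧ Tendsto θ atTop (𝓝 0))
  solves : IsSolution c α β h μ (magnetization s Ω θ φ)

/-- A wall is homogeneous if its local wavenumber `q = φ'` vanishes identically. -/
def IsHomogeneous (φ : ℝ → ℝ) : Prop := ∀ ξ, deriv φ ξ = 0

/-- `f` has a limit in `ℝ ∪ {∞}` along `l`. -/
def HasExtendedLimit (f : ℝ → ℝ) (l : Filter ℝ) : Prop :=
  (∃ a : ℝ, Tendsto f l (𝓝 a)) ∨ Tendsto f l atTop

/-- A wall is flat if `|q|`, with `q = φ'`, has a limit in `ℝ ∪ {∞}` at each of the two ends. -/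
def IsFlat (φ : ℝ → ℝ) : Prop :=
  HasExtendedLimit (fun ξ => |deriv φ ξ|) atBot ∧ HasExtendedLimit (fun ξ => |deriv φ ξ|) atTop

/-- The curve `(θ, p, q)` with `p = θ' / sin θ` and `q = φ'`, in which the profile equations form
a regular autonomous first-order system. -/
def phaseCurve (θ φ : ℝ → ℝ) (ξ : ℝ) : ℝ × ℝ × ℝ :=
  (θ ξ, deriv θ ξ / Real.sin (θ ξ), deriv φ ξ)

/-- Polar angle of the explicit homogeneous wall. -/
def theta0 (μ : ℝ) (ξ : ℝ) : ℝ := 2 * Real.arctan (Real.exp (Real.sqrt (-μ) * ξ))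

/-- Azimuthal angle of the explicit homogeneous wall. -/
def phi0 (_ : ℝ) : ℝ := 0

/-- Speed of the explicit homogeneous wall. -/
def speed0 (α β h μ : ℝ) : ℝ := (α * h - β) / (Real.sqrt (-μ) * (1 + α ^ 2))

/-- Frequency of the explicit homogeneous wall. -/
def freq0 (α β h : ℝ) : ℝ := (h + α * β) / (1 + α ^ 2)

end LLGS

end

noncomputable section

namespace LLGS

open MeasureTheory BoundedContinuousFunction

/-! ### The inverse of `d/du + k` on bounded continuous functions -/

/-! With `z = p + i q`, the profile equations become `θ' = p sin θ` together with a Riccati equation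
`z' = riccati P t z`, where `t = -cos θ`. As long as `p > 0`, the variable `u = log tan (θ / 2)`
satisfies `u' = p` and `t = tanh u`, so it can replace `ξ`. What remains is the single nonautonomous
equation `dz/du = slope P (tanh u) z` on the whole line, and nearby walls correspond to its
solutions that stay near a constant.

At the base parameters the constant `z = σ = √(-μ₀)` is a solution, because `riccati` vanishes at
`σ` for every `t`. The linearization there is multiplication by `(2 t σ - (α₀ + i) s₀) / σ`. The
codim-0 condition says exactly that `2 σ < α₀ s₀`, so the real part of this factor is negative,
uniformly in `t ∈ [-1, 1]`. Solutions near `σ` therefore contract as `u` increases, and for each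
nearby parameter exactly one solution stays near `σ` for all `u`. No matching condition arises, so
all seven parameters are free.

Such solutions are the fixed points of `w ↦ (d/du + k)⁻¹ (k w + slope P T w)` on bounded continuous
functions. For a suitable large `k` this map is a contraction near `σ` (`exists_lipschitz`,
`norm_profileMap_sub_le`). It preserves the existence of limits at `±∞`, which gives flatness. The
implicit function theorem gives smoothness in `P`; smoothness jointly in `u` comes from letting the
translate of `tanh` be a further parameter (`contDiff_tanhB`, `exists_contDiffAt_translates`). The
wall is recovered from `ξ = ∫ du / p` and `φ = ∫ (q / p) du`, and uniqueness of the fixed point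
gives local uniqueness of walls.

If `q ≡ 0`, the imaginary part of the equation makes `p` a rational function of `t`, and the real
part then gives a polynomial identity. Its value at the pole `t = 1 / c` forces `β c = 0`; after
that `p` is constant and `s`, `Ω` are determined (`polar_current_eq_zero`,
`IsProfileFamily.eq_of_isHomogeneous`). -/

theorem integrableOn_exp_neg_mul {k : ℝ} (hk : 0 < k) :
    IntegrableOn (fun r : ℝ => Real.exp (-k * r)) (Ioi 0) :=
  integrableOn_exp_mul_Ioi (by linarith) 0

theorem integral_exp_neg_mul {k : ℝ} (hk : 0 < k) :
    ∫ r in Ioi (0 : ℝ), Real.exp (-k * r) = k⁻¹ := by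
  rw [integral_exp_mul_Ioi (by linarith)]
  simp [neg_div_neg_eq]

/-- The solution operator of `w' + k w = f`, as an integral over the past. -/
def resolventFun (k : ℝ) (f : ℝ → ℂ) (u : ℝ) : ℂ :=
  ∫ r in Ioi (0 : ℝ), Real.exp (-k * r) • f (u - r)

theorem norm_smul_exp_le {k C : ℝ} {f : ℝ → ℂ} (hf : ∀ v, ‖f v‖ ≤ C) (u r : ℝ) :
    ‖Real.exp (-k * r) • f (u - r)‖ ≤ C * Real.exp (-k * r) := by
  rw [norm_smul, Real.norm_eq_abs, Real.abs_exp, mul_comm]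
  gcongr
  exact hf _

theorem integrable_resolventFun {k : ℝ} (hk : 0 < k) (f : ℝ →ᵇ ℂ) (u : ℝ) :
    IntegrableOn (fun r => Real.exp (-k * r) • f (u - r)) (Ioi (0 : ℝ)) := by
  refine Integrable.mono' ((integrableOn_exp_neg_mul hk).const_mul ‖f‖) ?_
    (ae_of_all _ fun r => norm_smul_exp_le f.norm_coe_le_norm u r)
  exact Continuous.aestronglyMeasurable (by fun_prop)

theorem norm_resolventFun_le {k : ℝ} (hk : 0 < k) (f : ℝ →ᵇ ℂ) (u : ℝ) :
    ‖resolventFun k f u‖ ≤ k⁻¹ * ‖f‖ := by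
  refine (norm_integral_le_of_norm_le ((integrableOn_exp_neg_mul hk).const_mul ‖f‖)
    (ae_of_all _ fun r => norm_smul_exp_le f.norm_coe_le_norm u r)).trans ?_
  rw [integral_const_mul, integral_exp_neg_mul hk, mul_comm]

theorem continuous_resolventFun {k : ℝ} (hk : 0 < k) (f : ℝ →ᵇ ℂ) :
    Continuous (resolventFun k f) := by
  refine continuous_of_dominated (bound := fun r => ‖f‖ * Real.exp (-k * r)) (fun u => ?_)
    (fun u => ae_of_all _ fun r => norm_smul_exp_le f.norm_coe_le_norm u r)
    ((integrableOn_exp_neg_mul hk).const_mul ‖f‖) (ae_of_all _ fun r => ?_)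
  · exact Continuous.aestronglyMeasurable (by fun_prop)
  · fun_prop

/-- The inverse of `d/du + k` as a bounded operator. -/
def resolvent (k : ℝ) (hk : 0 < k) : (ℝ →ᵇ ℂ) →L[ℝ] (ℝ →ᵇ ℂ) :=
  LinearMap.mkContinuous
    { toFun := fun f => BoundedContinuousFunction.ofNormedAddCommGroup (resolventFun k f)
        (continuous_resolventFun hk f) (k⁻¹ * ‖f‖) (norm_resolventFun_le hk f)
      map_add' := fun f g => by
        ext u
        simp only [resolventFun, coe_add, Pi.add_apply, smul_add, coe_ofNormedAddCommGroup]
        exact integral_add (integrable_resolventFun hk f u) (integrable_resolventFun hk g u)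
      map_smul' := fun a f => by
        ext u
        simp only [resolventFun, coe_smul, smul_comm _ a, coe_ofNormedAddCommGroup,
          RingHom.id_apply]
        exact integral_smul a _ }
    k⁻¹ fun f => norm_ofNormedAddCommGroup_le (continuous_resolventFun hk f) (by positivity)
      (norm_resolventFun_le hk f)

theorem norm_resolvent_apply_le {k : ℝ} (hk : 0 < k) (f : ℝ →ᵇ ℂ) :
    ‖resolvent k hk f‖ ≤ k⁻¹ * ‖f‖ :=
  norm_ofNormedAddCommGroup_le (continuous_resolventFun hk f) (by positivity)
    (norm_resolventFun_le hk f)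

/-- Dominated convergence; the hypothesis on `l` is invariance under translations, which `atBot` and
`atTop` satisfy. Used for flatness. -/
theorem tendsto_resolvent {k : ℝ} (hk : 0 < k) (f : ℝ →ᵇ ℂ) {l : Filter ℝ}
    [l.IsCountablyGenerated] (hl : ∀ r, Tendsto (fun u => u - r) l l) {a : ℂ}
    (hf : Tendsto f l (𝓝 a)) : ∃ b, Tendsto (resolvent k hk f) l (𝓝 b) := by
  refine ⟨_, tendsto_integral_filter_of_dominated_convergence
    (f := fun r => Real.exp (-k * r) • a) (fun r => ‖f‖ * Real.exp (-k * r))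
    (Eventually.of_forall fun u => ?_)
    (Eventually.of_forall fun u => ae_of_all _ fun r => norm_smul_exp_le f.norm_coe_le_norm u r)
    ((integrableOn_exp_neg_mul hk).const_mul ‖f‖) (ae_of_all _ fun r => ?_)⟩
  · exact Continuous.aestronglyMeasurable (by fun_prop)
  · exact (hf.comp (hl r)).const_smul _

/-- Substituting `v = u - r` moves `u` out of the argument of the merely continuous `f`, so that the
integral can be differentiated in `u`. -/
theorem resolventFun_eq {k : ℝ} (f : ℝ →ᵇ ℂ) (u : ℝ) :
    resolventFun k f u = Real.exp (-k * u) • ∫ v in Iic u, Real.exp (k * v) • f v := by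
  have h := integral_sub_left_eq_self
    ((Ioi (0 : ℝ)).indicator fun r => Real.exp (-k * r) • f (u - r)) volume u
  rw [integral_indicator measurableSet_Ioi] at h
  rw [resolventFun, ← h, ← integral_smul, integral_Iic_eq_integral_Iio,
    ← integral_indicator measurableSet_Iio]
  clear h
  congr 1
  ext v
  by_cases hv : v < u
  · rw [indicator_of_mem (show u - v ∈ Ioi 0 by simpa using hv),
      indicator_of_mem (show v ∈ Iio u from hv), smul_smul, ← Real.exp_add, sub_sub_cancel]
    congr 2
    ring_nf
  · rw [indicator_of_notMem (by simpa using hv), indicator_of_notMem (by simpa using hv)]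

theorem integrableOn_exp_smul_Iic {k : ℝ} (hk : 0 < k) (f : ℝ →ᵇ ℂ) (u : ℝ) :
    IntegrableOn (fun v => Real.exp (k * v) • f v) (Iic u) := by
  refine Integrable.mono' ((integrableOn_exp_mul_Iic hk u).const_mul ‖f‖) ?_
    (ae_of_all _ fun v => ?_)
  · exact Continuous.aestronglyMeasurable (by fun_prop)
  · rw [norm_smul, Real.norm_eq_abs, Real.abs_exp, mul_comm]
    gcongr
    exact f.norm_coe_le_norm v

theorem hasDerivAt_resolvent {k : ℝ} (hk : 0 < k) (f : ℝ →ᵇ ℂ) (u : ℝ) :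
    HasDerivAt (resolvent k hk f) (f u - k * resolvent k hk f u) u := by
  have hI : HasDerivAt (fun x => ∫ v in Iic x, Real.exp (k * v) • f v)
      (Real.exp (k * u) • f u) u := by
    have h1 : HasDerivAt (fun x => ∫ v in (0 : ℝ)..x, Real.exp (k * v) • f v)
        (Real.exp (k * u) • f u) u := by
      have hc : Continuous fun v => Real.exp (k * v) • f v := by fun_prop
      exact intervalIntegral.integral_hasDerivAt_right (hc.intervalIntegrable _ _)
        (hc.stronglyMeasurableAtFilter _ _) hc.continuousAt
    refine (h1.const_add (∫ v in Iic (0 : ℝ), Real.exp (k * v) • f v)).congr_of_eventuallyEq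
      (Eventually.of_forall fun x => ?_)
    dsimp only
    rw [← intervalIntegral.integral_Iic_sub_Iic (integrableOn_exp_smul_Iic hk f 0)
      (integrableOn_exp_smul_Iic hk f x)]
    abel
  have hE : HasDerivAt (fun x : ℝ => Real.exp (-k * x)) (Real.exp (-k * u) * (-k)) u := by
    simpa using ((hasDerivAt_id u).const_mul (-k)).exp
  have hfun : (resolvent k hk f : ℝ → ℂ) =
      fun x => Real.exp (-k * x) • ∫ v in Iic x, Real.exp (k * v) • f v :=
    funext fun x => resolventFun_eq f x
  rw [hfun]
  refine (hE.smul hI).congr_deriv ?_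
  rw [smul_smul, ← Real.exp_add, neg_mul, neg_add_cancel, Real.exp_zero, one_smul]
  simp only [Complex.real_smul, Complex.ofReal_mul, Complex.ofReal_neg]
  ring_nf

/-- The function `exp (k x) D x` is constant, and boundedness of `D` makes it tend to `0` at `-∞`.
-/
theorem eq_zero_of_bounded_of_hasDerivAt {k C : ℝ} (hk : 0 < k) {D : ℝ → ℂ}
    (hb : ∀ u, ‖D u‖ ≤ C) (hD : ∀ u, HasDerivAt D (-k * D u) u) (u : ℝ) : D u = 0 := by
  have hE : ∀ x, HasDerivAt (fun x : ℝ => Real.exp (k * x) • D x) 0 x := fun x => by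
    have hE : HasDerivAt (fun x : ℝ => Real.exp (k * x)) (Real.exp (k * x) * k) x := by
      simpa using ((hasDerivAt_id x).const_mul k).exp
    refine (hE.smul (hD x)).congr_deriv ?_
    simp only [Complex.real_smul, Complex.ofReal_mul]
    ring
  have hc : ∀ x, Real.exp (k * x) • D x = Real.exp (k * u) • D u := fun x =>
    is_const_of_deriv_eq_zero (fun x => (hE x).differentiableAt) (fun x => (hE x).deriv) x u
  have ht : Tendsto (fun x : ℝ => Real.exp (k * x) * C) atBot (𝓝 0) := by
    simpa using (Real.tendsto_exp_atBot.comp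
      ((tendsto_const_mul_atBot_of_pos hk).2 tendsto_id)).mul_const C
  have hle : ‖Real.exp (k * u) • D u‖ ≤ 0 := by
    refine ge_of_tendsto' ht fun x => ?_
    rw [← hc x, norm_smul, Real.norm_eq_abs, Real.abs_exp]
    gcongr
    exact hb x
  have := norm_le_zero_iff.1 hle
  rcases smul_eq_zero.1 this with h | h
  · exact absurd h (Real.exp_ne_zero _)
  · exact h

theorem eq_resolvent_iff {k : ℝ} (hk : 0 < k) (w f : ℝ →ᵇ ℂ) :
    resolvent k hk f = w ↔ ∀ u, HasDerivAt w (f u - k * w u) u := by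
  constructor
  · rintro rfl u
    exact hasDerivAt_resolvent hk f u
  · intro h
    have := eq_zero_of_bounded_of_hasDerivAt hk (D := resolvent k hk f - w)
      (C := ‖resolvent k hk f - w‖) (fun u => (resolvent k hk f - w).norm_coe_le_norm u)
      (fun u => ((hasDerivAt_resolvent hk f u).sub (h u)).congr_deriv (by simp; ring))
    ext u
    exact sub_eq_zero.1 (this u)

/-! ### The vector field and its superposition operator -/

/-- Right-hand side of the equation for `z = p + i q` at `cos θ = -t`. -/
def riccati (P : Param) (t : ℝ) (z : ℂ) : ℂ :=
  t * (z * z + P.2.2.2.2.1) - (P.2.1 + Complex.I) * P.2.2.2.2.2.1 * z +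
    (P.2.2.2.1 - Complex.I * P.2.2.1 * (1 - P.1 * t : ℂ)⁻¹) -
    P.2.2.2.2.2.2 * (1 - Complex.I * P.2.1)

/-- Right-hand side of the equation for `z` when `u = log tan (θ / 2)` is the independent
variable, for `t = tanh u`. -/
def slope (P : Param) (t : ℝ) (z : ℂ) : ℂ := (z.re : ℂ)⁻¹ * riccati P t z

theorem isUnit_of_le_norm {f : ℝ →ᵇ ℂ} {δ : ℝ} (hδ : 0 < δ) (h : ∀ u, δ ≤ ‖f u‖) : IsUnit f := by
  have h0 : ∀ u, f u ≠ 0 := fun u => norm_pos_iff.1 (hδ.trans_le (h u))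
  refine IsUnit.of_mul_eq_one (BoundedContinuousFunction.ofNormedAddCommGroup (fun u => (f u)⁻¹)
    (f.continuous.inv₀ h0) δ⁻¹ fun u => ?_) ?_
  · rw [norm_inv]
    exact inv_anti₀ hδ (h u)
  · ext u
    simp [h0 u]

theorem ringInverse_apply {f : ℝ →ᵇ ℂ} (h : IsUnit f) (u : ℝ) : Ring.inverse f u = (f u)⁻¹ := by
  have h1 : Ring.inverse f u * f u = 1 := by
    have := congrArg (fun g : ℝ →ᵇ ℂ => g u) (Ring.inverse_mul_cancel f h)
    simpa using this
  exact eq_inv_of_mul_eq_one_left h1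

/-- The real part of a bounded continuous function. -/
def reB : (ℝ →ᵇ ℂ) →L[ℝ] (ℝ →ᵇ ℂ) :=
  ContinuousLinearMap.compLeftContinuousBounded ℝ (Complex.ofRealCLM ∘L Complex.reCLM)

theorem reB_apply (w : ℝ →ᵇ ℂ) (u : ℝ) : reB w u = ((w u).re : ℂ) := rfl

/-- The constant function `i`. -/
def iB : ℝ →ᵇ ℂ := BoundedContinuousFunction.const ℝ Complex.I

/-- The superposition operator of `slope`. -/
def slopeB (P : Param) (T w : ℝ →ᵇ ℂ) : ℝ →ᵇ ℂ :=
  Ring.inverse (reB w) *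
    (T * (w * w + P.2.2.2.2.1 • 1) - (P.2.1 • 1 + iB) * (P.2.2.2.2.2.1 • w) +
      (P.2.2.2.1 • 1 - iB * (P.2.2.1 • Ring.inverse (1 - P.1 • T))) -
      P.2.2.2.2.2.2 • (1 - P.2.1 • iB))

theorem isUnit_reB {w : ℝ →ᵇ ℂ} {δ : ℝ} (hδ : 0 < δ) (hw : ∀ u, δ ≤ (w u).re) :
    IsUnit (reB w) :=
  isUnit_of_le_norm hδ fun u => by
    rw [reB_apply, Complex.norm_real]
    exact (hw u).trans (le_abs_self _)

theorem isUnit_one_sub_smul {T : ℝ →ᵇ ℂ} {c : ℝ} (hc : |c| < 1) (hT : ∀ u, ‖T u‖ ≤ 1) :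
    IsUnit (1 - c • T) :=
  isUnit_of_le_norm (sub_pos.2 hc) fun u => by
    have h1 : ‖(c • T) u‖ ≤ |c| := by
      rw [coe_smul, norm_smul, Real.norm_eq_abs]
      exact mul_le_of_le_one_right (abs_nonneg _) (hT u)
    have h2 := norm_sub_norm_le (1 : ℂ) ((c • T) u)
    simp only [norm_one] at h2
    calc 1 - |c| ≤ 1 - ‖(c • T) u‖ := by linarith
      _ ≤ _ := h2

theorem slopeB_apply {P : Param} {T w : ℝ →ᵇ ℂ} (hP : |P.1| < 1) {δ : ℝ} (hδ : 0 < δ)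
    (hw : ∀ u, δ ≤ (w u).re) {u t : ℝ} (hT : ∀ u, ‖T u‖ ≤ 1) (ht : T u = t) :
    slopeB P T w u = slope P t (w u) := by
  simp only [slopeB, mul_apply, BoundedContinuousFunction.sub_apply,
    BoundedContinuousFunction.add_apply, ringInverse_apply (isUnit_reB hδ hw),
    ringInverse_apply (isUnit_one_sub_smul hP hT), slope, riccati, reB_apply, iB, coe_smul,
    Complex.real_smul, ht, const_apply, BoundedContinuousFunction.coe_one, Pi.one_apply]
  ring

/-- `slopeB` is built from the operations of the Banach algebra of bounded continuous functions, so
its smoothness reduces to that of inversion at units. -/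
theorem contDiffAt_slopeB {P : Param} {T w : ℝ →ᵇ ℂ} (hP : IsUnit (1 - P.1 • T))
    (hw : IsUnit (reB w)) :
    ContDiffAt ℝ ∞ (fun x : Param × (ℝ →ᵇ ℂ) × (ℝ →ᵇ ℂ) => slopeB x.1 x.2.1 x.2.2) (P, T, w) := by
  obtain ⟨a, ha⟩ := hP
  obtain ⟨b, hb⟩ := hw
  have h1 : ContDiffAt ℝ ∞ (fun x : Param × (ℝ →ᵇ ℂ) × (ℝ →ᵇ ℂ) =>
      Ring.inverse (1 - x.1.1 • x.2.1)) (P, T, w) := by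
    have := contDiffAt_ringInverse ℝ a (n := ∞)
    rw [ha] at this
    refine ContDiffAt.comp (P, T, w) (g := Ring.inverse)
      (f := fun x : Param × (ℝ →ᵇ ℂ) × (ℝ →ᵇ ℂ) => 1 - x.1.1 • x.2.1) this ?_
    fun_prop
  have h2 : ContDiffAt ℝ ∞ (fun x : Param × (ℝ →ᵇ ℂ) × (ℝ →ᵇ ℂ) =>
      Ring.inverse (reB x.2.2)) (P, T, w) := by
    have := contDiffAt_ringInverse ℝ b (n := ∞)
    rw [hb] at this
    refine ContDiffAt.comp (P, T, w) (g := Ring.inverse)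
      (f := fun x : Param × (ℝ →ᵇ ℂ) × (ℝ →ᵇ ℂ) => reB x.2.2) this ?_
    fun_prop
  unfold slopeB
  fun_prop

/-! ### The shifted hyperbolic tangent -/

theorem contDiff_tanh : ContDiff ℝ ∞ Real.tanh := by
  have : Real.tanh = fun x => Real.sinh x / Real.cosh x := funext Real.tanh_eq_sinh_div_cosh
  rw [this]
  exact Real.contDiff_sinh.div Real.contDiff_cosh fun x => (Real.cosh_pos x).ne'

theorem continuous_tanh : Continuous Real.tanh := contDiff_tanh.continuous

theorem tanh_add (x y : ℝ) :
    Real.tanh (x + y) = (Real.tanh x + Real.tanh y) / (1 + Real.tanh x * Real.tanh y) := by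
  have hx := (Real.cosh_pos x).ne'
  have hy := (Real.cosh_pos y).ne'
  have hxy := (Real.cosh_pos (x + y)).ne'
  simp only [Real.tanh_eq_sinh_div_cosh]
  rw [Real.cosh_add] at *
  rw [Real.sinh_add]
  have : 1 + Real.sinh x / Real.cosh x * (Real.sinh y / Real.cosh y) =
      (Real.cosh x * Real.cosh y + Real.sinh x * Real.sinh y) / (Real.cosh x * Real.cosh y) := by
    field_simp
  rw [this]
  field_simp

/-- `u ↦ tanh (u + τ)` as a bounded continuous function. -/
def tanhB (τ : ℝ) : ℝ →ᵇ ℂ :=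
  BoundedContinuousFunction.ofNormedAddCommGroup (fun u => (Real.tanh (u + τ) : ℂ))
    (Complex.continuous_ofReal.comp (continuous_tanh.comp (continuous_id.add continuous_const))) 1
    fun u => by simpa [Complex.norm_real, -Complex.ofReal_tanh] using (Real.abs_tanh_lt_one _).le

theorem tanhB_apply (τ u : ℝ) : tanhB τ u = (Real.tanh (u + τ) : ℂ) := rfl

theorem norm_tanhB_apply_le (τ u : ℝ) : ‖tanhB τ u‖ ≤ 1 := by
  rw [tanhB_apply, Complex.norm_real]
  exact (Real.abs_tanh_lt_one _).le

/-- Translation is not a smooth action on bounded continuous functions in general. For `tanh` the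
addition formula writes the translate as a rational expression in `tanhB 0` with coefficients
depending on `tanh τ`, which is smooth in the sup norm. -/
theorem contDiff_tanhB : ContDiff ℝ ∞ tanhB := by
  have hu : ∀ τ, IsUnit (1 - (-Real.tanh τ) • tanhB 0) := fun τ =>
    isUnit_one_sub_smul (by rw [abs_neg]; exact Real.abs_tanh_lt_one τ) (norm_tanhB_apply_le 0)
  have he : tanhB = fun τ => (tanhB 0 + Real.tanh τ • 1) *
      Ring.inverse (1 - (-Real.tanh τ) • tanhB 0) := by
    ext τ u
    rw [mul_apply, ringInverse_apply (hu τ)]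
    simp only [BoundedContinuousFunction.add_apply, BoundedContinuousFunction.sub_apply, coe_smul,
      BoundedContinuousFunction.coe_one, Pi.one_apply, tanhB_apply, add_zero,
      Complex.real_smul, tanh_add u τ]
    push_cast
    rw [div_eq_mul_inv]
    congr 2 <;> ring
  have ht := contDiff_tanh
  rw [he]
  refine ContDiff.mul (by fun_prop) ?_
  refine contDiff_iff_contDiffAt.2 fun τ => ?_
  obtain ⟨a, ha⟩ := hu τ
  have := contDiffAt_ringInverse ℝ a (n := ∞)
  rw [ha] at this
  refine ContDiffAt.comp τ (g := Ring.inverse) (f := fun τ => 1 - (-Real.tanh τ) • tanhB 0) this ?_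
  fun_prop

/-! ### Uniform contraction estimate for the vector field -/

/-- A bounded set in `Re a ≥ δ` lies in a disc around a large real `k` of radius less than `k`. The
choice of `k` means `k δ = M² + δ²`, which beats the term `‖a‖²` in `‖k - a‖² = k² - 2 k Re a +
‖a‖²`. -/
theorem norm_sub_lt_of_re {a : ℂ} {δ M k : ℝ} (hδ : 0 < δ) (ha : δ ≤ a.re) (hM : ‖a‖ ≤ M)
    (hk : k = M ^ 2 / δ + δ) : ‖(k : ℂ) - a‖ < k - δ / 4 := by
  have hkδ : k * δ = M ^ 2 + δ ^ 2 := by rw [hk]; field_simp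
  have hk1 : δ ≤ k := by rw [hk]; have : 0 ≤ M ^ 2 / δ := by positivity
                         linarith
  have hn : ‖a‖ ^ 2 ≤ M ^ 2 := pow_le_pow_left₀ (norm_nonneg _) hM 2
  have h1 : ‖(k : ℂ) - a‖ ^ 2 = k ^ 2 - 2 * k * a.re + ‖a‖ ^ 2 := by
    rw [Complex.sq_norm, Complex.sq_norm, Complex.normSq_apply, Complex.normSq_apply]
    simp
    ring
  refine lt_of_pow_lt_pow_left₀ 2 (by linarith) ?_
  rw [h1]
  nlinarith [mul_le_mul_of_nonneg_left ha (hδ.le.trans hk1), mul_pos hδ hδ]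

/-- Local Lipschitz modulus of `z ↦ k z + slope P t z`. -/
def lipModulus (k : ℝ) (P : Param) (t : ℝ) (z z' : ℂ) : ℝ :=
  ‖(k : ℂ) + (z.re : ℂ)⁻¹ * (t * (z + z') - (P.2.1 + Complex.I) * P.2.2.2.2.2.1)‖ +
    ‖(z.re : ℂ)⁻¹ * (z'.re : ℂ)⁻¹ * riccati P t z'‖

/-- `riccati` is quadratic in `z`, so its difference factors exactly through `z - z'`. The variation
of `1 / Re z` contributes only a multiple of `riccati P t z'`, which vanishes at the base point. -/
theorem norm_slope_sub_le (k : ℝ) (P : Param) (t : ℝ) {z z' : ℂ} (hz : z.re ≠ 0)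
    (hz' : z'.re ≠ 0) :
    ‖(k * z + slope P t z) - (k * z' + slope P t z')‖ ≤ lipModulus k P t z z' * ‖z - z'‖ := by
  have e : (k * z + slope P t z) - (k * z' + slope P t z') =
      ((k : ℂ) + (z.re : ℂ)⁻¹ * (t * (z + z') - (P.2.1 + Complex.I) * P.2.2.2.2.2.1)) * (z - z') -
      ((z.re : ℂ)⁻¹ * (z'.re : ℂ)⁻¹ * riccati P t z') * ((z - z').re : ℂ) := by
    have h : (z.re : ℂ) ≠ 0 := Complex.ofReal_ne_zero.2 hz
    have h' : (z'.re : ℂ) ≠ 0 := Complex.ofReal_ne_zero.2 hz'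
    have hinv : (z.re : ℂ)⁻¹ - (z'.re : ℂ)⁻¹ =
        -((z.re : ℂ)⁻¹ * (z'.re : ℂ)⁻¹ * ((z - z').re : ℂ)) := by
      rw [Complex.sub_re, Complex.ofReal_sub]
      field_simp
      ring
    have hr : riccati P t z - riccati P t z' =
        (t * (z + z') - (P.2.1 + Complex.I) * P.2.2.2.2.2.1) * (z - z') := by
      unfold riccati
      ring
    simp only [slope]
    linear_combination (z.re : ℂ)⁻¹ * hr + riccati P t z' * hinv
  rw [e, lipModulus, add_mul _ _ ‖z - z'‖]
  refine (norm_sub_le _ _).trans ?_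
  rw [norm_mul, norm_mul _ (((z - z').re : ℝ) : ℂ), Complex.norm_real]
  gcongr
  exact Complex.abs_re_le_norm _

theorem one_sub_mul_ne_zero {c t : ℝ} (hc : |c| < 1) (ht : t ∈ Icc (-1 : ℝ) 1) :
    (1 - c * t : ℂ) ≠ 0 := by
  have h : |c * t| < 1 := by
    rw [abs_mul]
    exact (mul_le_of_le_one_right (abs_nonneg _) (abs_le.2 ht)).trans_lt hc
  have : 1 - c * t ≠ 0 := by linarith [(abs_lt.1 h).2]
  exact_mod_cast this

theorem continuousAt_lipModulus (k : ℝ) {P : Param} {t : ℝ} {z z' : ℂ} (hc : |P.1| < 1)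
    (ht : t ∈ Icc (-1 : ℝ) 1) (hz : z.re ≠ 0) (hz' : z'.re ≠ 0) :
    ContinuousAt (fun x : (Param × ℂ × ℂ) × ℝ => lipModulus k x.1.1 x.2 x.1.2.1 x.1.2.2)
      ((P, z, z'), t) := by
  have h1 := one_sub_mul_ne_zero hc ht
  have h : (z.re : ℂ) ≠ 0 := Complex.ofReal_ne_zero.2 hz
  have h' : (z'.re : ℂ) ≠ 0 := Complex.ofReal_ne_zero.2 hz'
  unfold lipModulus riccati
  have c0 := Complex.continuous_ofReal
  have c1 := Complex.continuous_re
  have e1 : ContinuousAt (fun x : (Param × ℂ × ℂ) × ℝ => (1 - x.1.1.1 * x.2 : ℂ)⁻¹)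
      ((P, z, z'), t) := ContinuousAt.inv₀ (by fun_prop) h1
  have e2 : ContinuousAt (fun x : (Param × ℂ × ℂ) × ℝ => (x.1.2.1.re : ℂ)⁻¹)
      ((P, z, z'), t) := ContinuousAt.inv₀ (by fun_prop) h
  have e3 : ContinuousAt (fun x : (Param × ℂ × ℂ) × ℝ => (x.1.2.2.re : ℂ)⁻¹)
      ((P, z, z'), t) := ContinuousAt.inv₀ (by fun_prop) h'
  fun_prop

theorem exists_lipschitz {P₀ : Param} {σ : ℝ} (hσ : 0 < σ) (hc : |P₀.1| < 1)
    (hs : 2 * σ < P₀.2.1 * P₀.2.2.2.2.2.1) (h0 : ∀ t, riccati P₀ t σ = 0) :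
    ∃ k κ r : ℝ, 0 < k ∧ 0 ≤ κ ∧ κ < 1 ∧ 0 < r ∧ r < σ ∧ ∀ᶠ P in 𝓝 P₀, ∀ t ∈ Icc (-1 : ℝ) 1,
      ∀ z ∈ Metric.closedBall (σ : ℂ) r, ∀ z' ∈ Metric.closedBall (σ : ℂ) r,
        ‖(k * z + slope P t z) - (k * z' + slope P t z')‖ ≤ κ * k * ‖z - z'‖ := by
  -- `a t` is minus the linearization of `slope P₀ t` at `σ`; its real part is smallest at `t = 1`,
  -- where it equals the `δ` below.
  set a : ℝ → ℂ := fun t =>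
    -((σ : ℂ)⁻¹ * (t * (σ + σ) - (P₀.2.1 + Complex.I) * P₀.2.2.2.2.2.1)) with ha
  have hac : Continuous a := by
    have c0 := Complex.continuous_ofReal
    fun_prop
  obtain ⟨M, hM⟩ := (isCompact_Icc (a := (-1 : ℝ)) (b := 1)).exists_bound_of_continuousOn
    hac.continuousOn
  set δ : ℝ := (P₀.2.1 * P₀.2.2.2.2.2.1 - 2 * σ) / σ with hδ
  have hδ0 : 0 < δ := div_pos (by linarith) hσ
  have hre : ∀ t ∈ Icc (-1 : ℝ) 1, δ ≤ (a t).re := fun t ht => by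
    have : (a t).re = (P₀.2.1 * P₀.2.2.2.2.2.1 - t * (2 * σ)) / σ := by
      simp only [ha, ← Complex.ofReal_inv, Complex.neg_re, Complex.re_ofReal_mul, Complex.sub_re,
        Complex.re_mul_ofReal, Complex.add_re, Complex.ofReal_re, Complex.I_re]
      field_simp
      ring
    rw [this, hδ]
    refine div_le_div_of_nonneg_right ?_ hσ.le
    nlinarith [ht.2]
  set k : ℝ := M ^ 2 / δ + δ with hk
  have hkδ : δ ≤ k := by
    have : 0 ≤ M ^ 2 / δ := by positivity
    linarith
  have hk0 : 0 < k := hδ0.trans_le hkδ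
  have hlt : ∀ t ∈ Icc (-1 : ℝ) 1, lipModulus k P₀ t σ σ < k - δ / 4 := fun t ht => by
    have := norm_sub_lt_of_re hδ0 (hre t ht) (hM t ht) hk
    simpa only [lipModulus, h0, mul_zero, norm_zero, add_zero, ha, sub_neg_eq_add,
      Complex.ofReal_re] using this
  -- The strict bound holds at the base point for each `t`; compactness of `[-1, 1]` gives one
  -- neighbourhood that serves all `t`.
  have hev : ∀ᶠ x : Param × ℂ × ℂ in 𝓝 (P₀, (σ : ℂ), (σ : ℂ)), ∀ t ∈ Icc (-1 : ℝ) 1,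
      lipModulus k x.1 t x.2.1 x.2.2 < k - δ / 4 := by
    refine isCompact_Icc.eventually_forall_of_forall_eventually fun t ht => ?_
    exact (continuousAt_lipModulus k hc ht (by simpa using hσ.ne')
      (by simpa using hσ.ne')).eventually_lt continuousAt_const (hlt t ht)
  rw [nhds_prod_eq] at hev
  obtain ⟨p, hp, q, hq, hpq⟩ := eventually_prod_iff.1 hev
  rw [nhds_prod_eq] at hq
  obtain ⟨q1, hq1, q2, hq2, hqq⟩ := eventually_prod_iff.1 hq
  obtain ⟨r, hr, hr'⟩ := Metric.nhds_basis_closedBall.eventually_iff.1 (hq1.and hq2)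
  -- With this `κ`, `κ k = k - δ / 4`; the radius is also at most `σ / 2` so that `Re z` stays away
  -- from `0`.
  refine ⟨k, 1 - δ / (4 * k), min r (σ / 2), hk0, ?_, ?_, by positivity,
    (min_le_right _ _).trans_lt (by linarith), hp.mono fun P hP t ht z hz z' hz' => ?_⟩
  · rw [sub_nonneg, div_le_one (by positivity)]
    linarith
  · have : 0 < δ / (4 * k) := by positivity
    linarith
  · have hnz : ∀ z ∈ Metric.closedBall (σ : ℂ) (min r (σ / 2)), z.re ≠ 0 := fun z hz => by
      have h1 : ‖z - σ‖ ≤ σ / 2 := (mem_closedBall_iff_norm.1 hz).trans (min_le_right _ _)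
      have h2 := (Complex.abs_re_le_norm (z - σ)).trans h1
      rw [Complex.sub_re, Complex.ofReal_re] at h2
      have := (abs_le.1 h2).1
      intro h
      linarith
    refine (norm_slope_sub_le k P t (hnz z hz) (hnz z' hz')).trans ?_
    have hlast := hpq hP (hqq (hr' (Metric.closedBall_subset_closedBall (min_le_left _ _) hz)).1
      (hr' (Metric.closedBall_subset_closedBall (min_le_left _ _) hz')).2) t ht
    have : (1 - δ / (4 * k)) * k = k - δ / 4 := by field_simp
    rw [this]
    gcongr

/-! ### Fixed points of contractions -/

/-- The closed invariant set `C` carries an additional property to the fixed point; it will be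
convergence at both ends. -/
theorem exists_fixedPoint_mem {F : Type*} [NormedAddCommGroup F] [CompleteSpace F] {G : F → F}
    {w₀ : F} {r κ : ℝ} {C : Set F} (hr : 0 ≤ r) (hκ : 0 ≤ κ) (hκ1 : κ < 1) (hC : IsClosed C)
    (hw₀ : w₀ ∈ C)
    (hG : ∀ w ∈ Metric.closedBall w₀ r, ∀ w' ∈ Metric.closedBall w₀ r,
      ‖G w - G w'‖ ≤ κ * ‖w - w'‖)
    (hmaps : ∀ w ∈ Metric.closedBall w₀ r, w ∈ C → G w ∈ C) (h₀ : ‖G w₀ - w₀‖ ≤ (1 - κ) * r) :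
    ∃ w ∈ Metric.closedBall w₀ r, w ∈ C ∧ G w = w := by
  have hs : MapsTo G (Metric.closedBall w₀ r ∩ C) (Metric.closedBall w₀ r ∩ C) := by
    rintro w ⟨hw, hwC⟩
    refine ⟨mem_closedBall_iff_norm.2 ?_, hmaps w hw hwC⟩
    have h1 := hG w hw w₀ (Metric.mem_closedBall_self hr)
    have h2 : κ * ‖w - w₀‖ ≤ κ * r := by
      gcongr
      exact mem_closedBall_iff_norm.1 hw
    calc ‖G w - w₀‖ = ‖(G w - G w₀) + (G w₀ - w₀)‖ := by rw [sub_add_sub_cancel]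
      _ ≤ κ * r + (1 - κ) * r := (norm_add_le _ _).trans (add_le_add (h1.trans h2) h₀)
      _ = r := by ring
  have hct : ContractingWith ⟨κ, hκ⟩ (hs.restrict G _ _) := by
    refine ⟨by exact_mod_cast hκ1, LipschitzWith.of_dist_le_mul fun w w' => ?_⟩
    rw [Subtype.dist_eq, Subtype.dist_eq, dist_eq_norm, dist_eq_norm]
    exact hG w w.2.1 w' w'.2.1
  obtain ⟨w, hw, hfix, -⟩ := hct.exists_fixedPoint' (Metric.isClosed_closedBall.inter hC).isComplete
    hs (x := w₀) ⟨Metric.mem_closedBall_self hr, hw₀⟩ (edist_ne_top _ _)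
  exact ⟨w, hw.1, hw.2, hfix⟩

/-- The Lipschitz bound at `x₁` gives `‖∂_w G‖ ≤ κ < 1`, so `1 - ∂_w G` is invertible by a Neumann
series and the implicit function theorem applies to `w - G (x, w)`. -/
theorem exists_contDiffAt_fixedPoint {E F : Type*} [NormedAddCommGroup E] [NormedSpace ℝ E]
    [CompleteSpace E] [NormedAddCommGroup F] [NormedSpace ℝ F] [CompleteSpace F]
    {G : E × F → F} {x₁ : E} {w₁ : F} {κ : ℝ} (hG : ContDiffAt ℝ ∞ G (x₁, w₁))
    (hfix : G (x₁, w₁) = w₁) (hκ : 0 ≤ κ) (hκ1 : κ < 1) {s : Set F} (hs : s ∈ 𝓝 w₁)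
    (hlip : ∀ w ∈ s, ∀ w' ∈ s, ‖G (x₁, w) - G (x₁, w')‖ ≤ κ * ‖w - w'‖) :
    ∃ ψ : E → F, ContDiffAt ℝ ∞ ψ x₁ ∧ ψ x₁ = w₁ ∧ ∀ᶠ x in 𝓝 x₁, G (x, ψ x) = ψ x := by
  have hf : ContDiffAt ℝ ∞ (fun y : E × F => y.2 - G y) (x₁, w₁) := contDiffAt_snd.sub hG
  have hd := (hf.differentiableAt (by simp)).hasFDerivAt
  have hA := hd.comp w₁ (hasFDerivAt_prodMk_right x₁ w₁)
  set A := fderiv ℝ (fun y : E × F => y.2 - G y) (x₁, w₁) ∘L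
    ContinuousLinearMap.inr ℝ E F with hAdef
  have hG1 : HasFDerivAt (fun w => G (x₁, w)) (1 - A) w₁ := by
    refine ((hasFDerivAt_id w₁).sub hA).congr_of_eventuallyEq (Eventually.of_forall fun w => ?_)
    simp
  have hn : ‖1 - A‖ ≤ (⟨κ, hκ⟩ : NNReal) :=
    hG1.le_of_lipschitzOn hs (LipschitzOnWith.of_dist_le_mul fun w hw w' hw' => by
      rw [dist_eq_norm, dist_eq_norm]
      exact hlip w hw w' hw')
  have hU : IsUnit A := by
    have := isUnit_one_sub_of_norm_lt_one (lt_of_le_of_lt hn hκ1)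
    rwa [sub_sub_cancel] at this
  have hinv : A.IsInvertible := by
    obtain ⟨a, ha⟩ := hU
    refine ⟨ContinuousLinearEquiv.ofUnit a, ?_⟩
    rw [← ha]
    rfl
  refine ⟨hf.implicitFunction (by simp) hinv, hf.contDiffAt_implicitFunction (by simp) hinv,
    hf.implicitFunction_apply_self (by simp) hinv, ?_⟩
  filter_upwards [hf.eventually_apply_implicitFunction (by simp) hinv] with x hx
  rw [hfix, sub_self, sub_eq_zero] at hx
  exact hx.symm

/-! ### Bounded solutions of the reduced equation -/

/-- The bounded solutions of `w' = slope P T w` are the fixed points of this map. -/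
def profileMap (k : ℝ) (hk : 0 < k) (P : Param) (T w : ℝ →ᵇ ℂ) : ℝ →ᵇ ℂ :=
  resolvent k hk (k • w + slopeB P T w)

theorem profileMap_eq_iff {k : ℝ} (hk : 0 < k) {P : Param} {T w : ℝ →ᵇ ℂ} (hP : |P.1| < 1) {δ : ℝ}
    (hδ : 0 < δ) (hw : ∀ u, δ ≤ (w u).re) (hT : ∀ u, ‖T u‖ ≤ 1) {t : ℝ → ℝ}
    (ht : ∀ u, T u = t u) :
    profileMap k hk P T w = w ↔ ∀ u, HasDerivAt w (slope P (t u) (w u)) u := by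
  rw [profileMap, eq_resolvent_iff]
  refine forall_congr' fun u => ?_
  simp only [BoundedContinuousFunction.add_apply, slopeB_apply hP hδ hw hT (ht u), coe_smul,
    Complex.real_smul, add_sub_cancel_left]

theorem contDiffAt_profileMap {k : ℝ} (hk : 0 < k) {P : Param} {T w : ℝ →ᵇ ℂ}
    (hP : IsUnit (1 - P.1 • T)) (hw : IsUnit (reB w)) :
    ContDiffAt ℝ ∞ (fun x : Param × (ℝ →ᵇ ℂ) × (ℝ →ᵇ ℂ) => profileMap k hk x.1 x.2.1 x.2.2)
      (P, T, w) := by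
  have := contDiffAt_slopeB hP hw
  unfold profileMap
  fun_prop

/-- The standing assumptions for the contraction argument. -/
structure Admissible (σ k κ r : ℝ) (P : Param) : Prop where
  abs_lt : |P.1| < 1
  lipschitz : ∀ t ∈ Icc (-1 : ℝ) 1, ∀ z ∈ Metric.closedBall (σ : ℂ) r,
    ∀ z' ∈ Metric.closedBall (σ : ℂ) r,
      ‖(k * z + slope P t z) - (k * z' + slope P t z')‖ ≤ κ * k * ‖z - z'‖

/-- The constant function with value `σ`. -/
def constB (σ : ℝ) : ℝ →ᵇ ℂ := BoundedContinuousFunction.const ℝ (σ : ℂ)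

theorem mem_closedBall_constB {σ r : ℝ} (hr : 0 ≤ r) {w : ℝ →ᵇ ℂ} :
    w ∈ Metric.closedBall (constB σ) r ↔ ∀ u, w u ∈ Metric.closedBall (σ : ℂ) r := by
  simp only [Metric.mem_closedBall]
  exact BoundedContinuousFunction.dist_le hr

theorem le_re_of_mem_closedBall {σ r : ℝ} {z : ℂ} (hz : z ∈ Metric.closedBall (σ : ℂ) r) :
    σ - r ≤ z.re := by
  have h := (Complex.abs_re_le_norm (z - σ)).trans (mem_closedBall_iff_norm.1 hz)
  rw [Complex.sub_re, Complex.ofReal_re] at h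
  linarith [(abs_le.1 h).1]

theorem norm_profileMap_sub_le {σ k κ r : ℝ} (hk : 0 < k) (hκ : 0 ≤ κ) (hr : 0 < r) (hrσ : r < σ)
    {P : Param} (hP : Admissible σ k κ r P) {T : ℝ →ᵇ ℂ} (hT : ∀ u, ‖T u‖ ≤ 1) {t : ℝ → ℝ}
    (ht : ∀ u, T u = t u) {w w' : ℝ →ᵇ ℂ} (hw : w ∈ Metric.closedBall (constB σ) r)
    (hw' : w' ∈ Metric.closedBall (constB σ) r) :
    ‖profileMap k hk P T w - profileMap k hk P T w'‖ ≤ κ * ‖w - w'‖ := by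
  rw [mem_closedBall_constB hr.le] at hw hw'
  have ht1 : ∀ u, t u ∈ Icc (-1 : ℝ) 1 := fun u => by
    have := hT u
    rw [ht u, Complex.norm_real] at this
    exact abs_le.1 this
  have hδ : 0 < σ - r := sub_pos.2 hrσ
  have h1 : ‖(k • w + slopeB P T w) - (k • w' + slopeB P T w')‖ ≤ κ * k * ‖w - w'‖ := by
    refine (BoundedContinuousFunction.norm_le (by positivity)).2 fun u => ?_
    simp only [BoundedContinuousFunction.sub_apply, BoundedContinuousFunction.add_apply, coe_smul,
      Complex.real_smul,
      slopeB_apply hP.abs_lt hδ (fun u => le_re_of_mem_closedBall (hw u)) hT (ht u),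
      slopeB_apply hP.abs_lt hδ (fun u => le_re_of_mem_closedBall (hw' u)) hT (ht u)]
    refine (hP.lipschitz _ (ht1 u) _ (hw u) _ (hw' u)).trans ?_
    gcongr
    exact (w - w').norm_coe_le_norm u
  rw [profileMap, profileMap, ← map_sub]
  refine (norm_resolvent_apply_le hk _).trans ?_
  calc k⁻¹ * _ ≤ k⁻¹ * (κ * k * ‖w - w'‖) := by gcongr
    _ = κ * ‖w - w'‖ := by field_simp

/-! ### Limits at infinity of the bounded solution. -/

theorem tendsto_slope {P : Param} (hP : |P.1| < 1) {t : ℝ → ℝ} {w : ℝ → ℂ} {l : Filter ℝ} {t₀ : ℝ}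
    {a : ℂ} (ht₀ : t₀ ∈ Icc (-1 : ℝ) 1) (ha : a.re ≠ 0) (ht : Tendsto t l (𝓝 t₀))
    (hw : Tendsto w l (𝓝 a)) :
    Tendsto (fun u => slope P (t u) (w u)) l (𝓝 (slope P t₀ a)) := by
  have ht' : Tendsto (fun u => (t u : ℂ)) l (𝓝 t₀) := (Complex.continuous_ofReal.tendsto _).comp ht
  have e1 : Tendsto (fun u => (1 - P.1 * t u : ℂ)⁻¹) l (𝓝 (1 - P.1 * t₀ : ℂ)⁻¹) :=
    ((ht'.const_mul _).const_sub _).inv₀ (one_sub_mul_ne_zero hP ht₀)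
  have e2 : Tendsto (fun u => ((w u).re : ℂ)⁻¹) l (𝓝 (a.re : ℂ)⁻¹) :=
    (((Complex.continuous_ofReal.comp Complex.continuous_re).tendsto a).comp hw).inv₀
      (Complex.ofReal_ne_zero.2 ha)
  exact e2.mul ((((ht'.mul ((hw.mul hw).add_const _)).sub (hw.const_mul _)).add
    ((e1.const_mul _).const_sub _)).sub_const _)

theorem isClosed_setOf_exists_tendsto (l : Filter ℝ) [l.NeBot] :
    IsClosed {w : ℝ →ᵇ ℂ | ∃ a, Tendsto w l (𝓝 a)} := by
  refine isClosed_of_closure_subset fun w hw => ?_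
  rw [mem_ofPred_eq, ← cauchy_map_iff_exists_tendsto, Metric.cauchy_iff]
  refine ⟨inferInstance, fun ε hε => ?_⟩
  obtain ⟨v, ⟨a, ha⟩, hv⟩ := Metric.mem_closure_iff.1 hw (ε / 4) (by positivity)
  refine ⟨Metric.ball a (ε / 2), ?_, fun x hx y hy => ?_⟩
  · change ∀ᶠ u in l, w u ∈ Metric.ball a (ε / 2)
    filter_upwards [ha.eventually (Metric.ball_mem_nhds a (by positivity : 0 < ε / 4))] with u hu
    have h1 := dist_coe_le_dist (f := w) (g := v) u
    have h2 : dist (v u) a < ε / 4 := hu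
    have h3 := dist_triangle (w u) (v u) a
    change dist (w u) a < ε / 2
    linarith
  · have := dist_triangle_right x y a
    rw [Metric.mem_ball] at hx hy
    linarith

theorem tendsto_tanh_atTop : Tendsto Real.tanh atTop (𝓝 1) := by
  have h : Real.tanh = fun x => 1 - 2 * (Real.exp (2 * x) + 1)⁻¹ := by
    ext x
    have := (Real.exp_pos x).ne'
    have h2 : Real.exp x * Real.exp x + 1 ≠ 0 := by positivity
    have h3 : Real.exp x + (Real.exp x)⁻¹ ≠ 0 := by positivity
    rw [Real.tanh_eq, Real.exp_neg, show 2 * x = x + x by ring, Real.exp_add]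
    field_simp
    ring
  rw [h]
  have : Tendsto (fun x : ℝ => (Real.exp (2 * x) + 1)⁻¹) atTop (𝓝 0) :=
    (tendsto_atTop_add_const_right _ _ (Real.tendsto_exp_atTop.comp
      (tendsto_id.const_mul_atTop two_pos))).inv_tendsto_atTop
  simpa using (this.const_mul 2).const_sub 1

theorem tendsto_tanh_atBot : Tendsto Real.tanh atBot (𝓝 (-1)) := by
  have := (tendsto_tanh_atTop.comp tendsto_neg_atBot_atTop).neg
  simpa [Function.comp_def, Real.tanh_neg] using this

/-- The bounded continuous functions with limits at `±∞`. -/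
def convergentB : Set (ℝ →ᵇ ℂ) :=
  {w | ∃ a, Tendsto w atBot (𝓝 a)} ∩ {w | ∃ a, Tendsto w atTop (𝓝 a)}

theorem profileMap_mem_convergentB {σ k r : ℝ} (hk : 0 < k) (hr : 0 < r) (hrσ : r < σ) {P : Param}
    (hP : |P.1| < 1) {w : ℝ →ᵇ ℂ} (hw : w ∈ Metric.closedBall (constB σ) r)
    (hc : w ∈ convergentB) : profileMap k hk P (tanhB 0) w ∈ convergentB := by
  rw [mem_closedBall_constB hr.le] at hw
  have key : ∀ (l : Filter ℝ) [l.NeBot] [l.IsCountablyGenerated] (t₀ : ℝ),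
      t₀ ∈ Icc (-1 : ℝ) 1 → (∀ r, Tendsto (fun u => u - r) l l) → Tendsto Real.tanh l (𝓝 t₀) →
      (∃ a, Tendsto w l (𝓝 a)) → ∃ a, Tendsto (profileMap k hk P (tanhB 0) w) l (𝓝 a) := by
    rintro l _ _ t₀ ht₀ hl ht ⟨a, ha⟩
    have ha' : a ∈ Metric.closedBall (σ : ℂ) r :=
      Metric.isClosed_closedBall.mem_of_tendsto ha (Eventually.of_forall hw)
    have ha0 : a.re ≠ 0 := by
      have := le_re_of_mem_closedBall ha'
      intro h0
      linarith
    refine tendsto_resolvent hk _ hl (a := k * a + slope P t₀ a) ?_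
    have h1 : (⇑(k • w + slopeB P (tanhB 0) w) : ℝ → ℂ) =
        fun u => k * w u + slope P (Real.tanh u) (w u) := by
      ext u
      rw [BoundedContinuousFunction.add_apply, slopeB_apply hP (sub_pos.2 hrσ)
        (fun u => le_re_of_mem_closedBall (hw u)) (norm_tanhB_apply_le 0) (tanhB_apply 0 u),
        add_zero]
      rfl
    rw [h1]
    exact (ha.const_mul _).add (tendsto_slope hP ht₀ ha0 ht ha)
  exact ⟨key atBot (-1) (by simp) (fun r => tendsto_atBot_add_const_right _ _ tendsto_id)
    tendsto_tanh_atBot hc.1,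
    key atTop 1 (by simp) (fun r => tendsto_atTop_add_const_right _ _ tendsto_id)
    tendsto_tanh_atTop hc.2⟩

/-! ### The family of bounded solutions of the reduced equation -/

/-- Both functions are fixed points of the same contraction, so no initial condition is needed. The
shift `τ` is there to compare translates. -/
theorem eq_of_hasDerivAt_slope {σ k κ r : ℝ} (hk : 0 < k) (hκ : 0 ≤ κ) (hκ1 : κ < 1) (hr : 0 < r)
    (hrσ : r < σ) {P : Param} (hP : Admissible σ k κ r P) (τ : ℝ) {ζ₁ ζ₂ : ℝ → ℂ}
    (h₁ : ∀ u, ζ₁ u ∈ Metric.closedBall (σ : ℂ) r) (h₂ : ∀ u, ζ₂ u ∈ Metric.closedBall (σ : ℂ) r)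
    (hd₁ : ∀ u, HasDerivAt ζ₁ (slope P (Real.tanh (u + τ)) (ζ₁ u)) u)
    (hd₂ : ∀ u, HasDerivAt ζ₂ (slope P (Real.tanh (u + τ)) (ζ₂ u)) u) : ζ₁ = ζ₂ := by
  have key : ∀ ζ : ℝ → ℂ, (∀ u, ζ u ∈ Metric.closedBall (σ : ℂ) r) →
      (∀ u, HasDerivAt ζ (slope P (Real.tanh (u + τ)) (ζ u)) u) →
      ∃ w : ℝ →ᵇ ℂ, ⇑w = ζ ∧ w ∈ Metric.closedBall (constB σ) r ∧
        profileMap k hk P (tanhB τ) w = w := by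
    intro ζ h hd
    have hc : Continuous ζ := continuous_iff_continuousAt.2 fun u => (hd u).continuousAt
    refine ⟨BoundedContinuousFunction.ofNormedAddCommGroup ζ hc (‖(σ : ℂ)‖ + r) fun u => ?_,
      rfl, (mem_closedBall_constB hr.le).2 h, ?_⟩
    · exact norm_le_norm_add_const_of_dist_le (h u)
    · exact (profileMap_eq_iff hk hP.abs_lt (sub_pos.2 hrσ)
        (fun u => le_re_of_mem_closedBall (h u)) (norm_tanhB_apply_le τ) (tanhB_apply τ)).2 hd
  obtain ⟨w₁, e₁, hw₁, f₁⟩ := key ζ₁ h₁ hd₁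
  obtain ⟨w₂, e₂, hw₂, f₂⟩ := key ζ₂ h₂ hd₂
  have h := norm_profileMap_sub_le hk hκ hr hrσ hP (norm_tanhB_apply_le τ) (tanhB_apply τ) hw₁ hw₂
  rw [f₁, f₂] at h
  have h0 : ‖w₁ - w₂‖ = 0 := by nlinarith [norm_nonneg (w₁ - w₂)]
  rw [← e₁, ← e₂, sub_eq_zero.1 (norm_eq_zero.1 h0)]

/-- The solution is found in the ball of radius `r / 2` although the contraction holds on radius
`r`: the larger ball is then a neighbourhood of it, as the implicit function theorem requires. -/
theorem exists_bounded_solution {σ k κ r : ℝ} (hk : 0 < k) (hκ : 0 ≤ κ) (hκ1 : κ < 1) (hr : 0 < r)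
    (hrσ : r < σ) {P : Param} (hP : Admissible σ k κ r P)
    (h₀ : ‖profileMap k hk P (tanhB 0) (constB σ) - constB σ‖ ≤ (1 - κ) * (r / 2)) :
    ∃ w : ℝ →ᵇ ℂ, (∀ u, w u ∈ Metric.closedBall (σ : ℂ) (r / 2)) ∧ w ∈ convergentB ∧
      ∀ u, HasDerivAt w (slope P (Real.tanh u) (w u)) u := by
  have hle : r / 2 ≤ r := by linarith
  obtain ⟨w, hw, hwc, hfix⟩ := exists_fixedPoint_mem (G := profileMap k hk P (tanhB 0))
    (w₀ := constB σ) (r := r / 2) (C := convergentB) (by positivity) hκ hκ1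
    ((isClosed_setOf_exists_tendsto _).inter (isClosed_setOf_exists_tendsto _))
    ⟨⟨_, tendsto_const_nhds⟩, ⟨_, tendsto_const_nhds⟩⟩
    (fun w hw w' hw' => norm_profileMap_sub_le hk hκ hr hrσ hP (norm_tanhB_apply_le 0)
      (tanhB_apply 0) (Metric.closedBall_subset_closedBall hle hw)
      (Metric.closedBall_subset_closedBall hle hw'))
    (fun w hw hwc => profileMap_mem_convergentB hk hr hrσ hP.abs_lt
      (Metric.closedBall_subset_closedBall hle hw) hwc) h₀
  have hw' := (mem_closedBall_constB (by positivity)).1 hw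
  refine ⟨w, hw', hwc, ?_⟩
  simpa using (profileMap_eq_iff hk hP.abs_lt (sub_pos.2 hrσ)
    (fun u => le_re_of_mem_closedBall (Metric.closedBall_subset_closedBall hle (hw' u)))
    (norm_tanhB_apply_le 0) (tanhB_apply 0)).1 hfix

/-- The translate of `Z P` by `τ` is a fixed point of the map for `tanhB τ`, so the implicit
function theorem in `(P, τ)` yields a smooth local branch. Uniqueness in the ball of radius `r`
identifies this branch with the translates. -/
theorem exists_contDiffAt_translates {σ k κ r : ℝ} (hk : 0 < k) (hκ : 0 ≤ κ) (hκ1 : κ < 1)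
    (hr : 0 < r) (hrσ : r < σ) {U : Set Param} (hU : ∀ P ∈ U, Admissible σ k κ r P)
    {Z : Param → ℝ → ℂ} (hZ : ∀ P ∈ U, ∀ u, Z P u ∈ Metric.closedBall (σ : ℂ) (r / 2))
    (hd : ∀ P ∈ U, ∀ u, HasDerivAt (Z P) (slope P (Real.tanh u) (Z P u)) u)
    {P₁ : Param} (hP₁ : P₁ ∈ U) (hU' : U ∈ 𝓝 P₁) (τ₁ : ℝ) :
    ∃ ψ : Param × ℝ → ℝ →ᵇ ℂ, ContDiffAt ℝ ∞ ψ (P₁, τ₁) ∧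
      ∀ᶠ x in 𝓝 (P₁, τ₁), ∀ u, ψ x u = Z x.1 (u + x.2) := by
  have hle : r / 2 ≤ r := by linarith
  have hsh : ∀ P ∈ U, ∀ τ u, HasDerivAt (fun u => Z P (u + τ))
      (slope P (Real.tanh (u + τ)) (Z P (u + τ))) u := fun P hP τ u =>
    (hd P hP (u + τ)).comp_add_const u τ
  set w₁ : ℝ →ᵇ ℂ := BoundedContinuousFunction.ofNormedAddCommGroup (fun u => Z P₁ (u + τ₁))
    (continuous_iff_continuousAt.2 fun u => (hsh P₁ hP₁ τ₁ u).continuousAt) (‖(σ : ℂ)‖ + r / 2)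
    (fun u => norm_le_norm_add_const_of_dist_le (hZ P₁ hP₁ _)) with hw₁
  have hb₁ : ∀ u, w₁ u ∈ Metric.closedBall (σ : ℂ) (r / 2) := fun u => hZ P₁ hP₁ (u + τ₁)
  have hw₁r : ∀ u, σ - r ≤ (w₁ u).re := fun u =>
    le_re_of_mem_closedBall (Metric.closedBall_subset_closedBall hle (hb₁ u))
  have hσr : 0 < σ - r := sub_pos.2 hrσ
  have hmem : Metric.closedBall (constB σ) r ∈ 𝓝 w₁ := by
    have h1 : w₁ ∈ Metric.ball (constB σ) r :=
      Metric.closedBall_subset_ball (by linarith)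
        ((mem_closedBall_constB (by positivity)).2 hb₁)
    exact Filter.mem_of_superset (Metric.isOpen_ball.mem_nhds h1) Metric.ball_subset_closedBall
  obtain ⟨ψ, hψ, hψ1, hψfix⟩ := exists_contDiffAt_fixedPoint
    (G := fun y : (Param × ℝ) × (ℝ →ᵇ ℂ) => profileMap k hk y.1.1 (tanhB y.1.2) y.2)
    (x₁ := (P₁, τ₁)) (w₁ := w₁) (κ := κ)
    (by
      have h1 := contDiffAt_profileMap hk (P := P₁) (T := tanhB τ₁) (w := w₁)
        (isUnit_one_sub_smul (hU P₁ hP₁).abs_lt (norm_tanhB_apply_le τ₁)) (isUnit_reB hσr hw₁r)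
      have h2 := contDiff_tanhB
      exact h1.comp (((P₁, τ₁), w₁) : (Param × ℝ) × (ℝ →ᵇ ℂ))
        (f := fun y : (Param × ℝ) × (ℝ →ᵇ ℂ) => (y.1.1, tanhB y.1.2, y.2)) (by fun_prop))
    ((profileMap_eq_iff hk (hU P₁ hP₁).abs_lt hσr hw₁r (norm_tanhB_apply_le τ₁)
      (tanhB_apply τ₁)).2 (hsh P₁ hP₁ τ₁)) hκ hκ1 hmem
    (fun w hw w' hw' => norm_profileMap_sub_le hk hκ hr hrσ (hU P₁ hP₁) (norm_tanhB_apply_le τ₁)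
      (tanhB_apply τ₁) hw hw')
  refine ⟨ψ, hψ, ?_⟩
  have hev : ∀ᶠ x in 𝓝 (P₁, τ₁), ψ x ∈ Metric.closedBall (constB σ) r := by
    have := hψ.continuousAt
    rw [ContinuousAt, hψ1] at this
    exact this.eventually hmem
  have hevU : ∀ᶠ x : Param × ℝ in 𝓝 (P₁, τ₁), x.1 ∈ U := continuousAt_fst.eventually hU'
  filter_upwards [hev, hevU, hψfix] with x hx hxU hfix u
  have hx' := (mem_closedBall_constB hr.le).1 hx
  have hxd := (profileMap_eq_iff hk (hU _ hxU).abs_lt hσr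
    (fun u => le_re_of_mem_closedBall (hx' u)) (norm_tanhB_apply_le x.2) (tanhB_apply x.2)).1 hfix
  exact congrFun (eq_of_hasDerivAt_slope hk hκ hκ1 hr hrσ (hU _ hxU) x.2 hx'
    (fun u => Metric.closedBall_subset_closedBall hle (hZ _ hxU _)) hxd (hsh _ hxU x.2)) u

/-- A family `Z` of bounded solutions of the reduced equation near the constant `σ`. -/
structure IsProfileFamily (P₀ : Param) (σ R : ℝ) (U : Set Param) (Z : Param → ℝ → ℂ) : Prop where
  isOpen : IsOpen U
  mem : P₀ ∈ U
  pos : 0 < R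
  lt : R < σ
  abs_lt : ∀ P ∈ U, |P.1| < 1
  near : ∀ P ∈ U, ∀ u, ‖Z P u - σ‖ ≤ R
  hasDerivAt : ∀ P ∈ U, ∀ u, HasDerivAt (Z P) (slope P (Real.tanh u) (Z P u)) u
  tendsto_atBot : ∀ P ∈ U, ∃ a, Tendsto (Z P) atBot (𝓝 a)
  tendsto_atTop : ∀ P ∈ U, ∃ a, Tendsto (Z P) atTop (𝓝 a)
  contDiffOn : ContDiffOn ℝ ∞ (fun x : Param × ℝ => Z x.1 x.2) (U ×ˢ univ)
  unique : ∀ P ∈ U, ∀ ζ : ℝ → ℂ, (∀ u, ‖ζ u - σ‖ ≤ R) →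
    (∀ u, HasDerivAt ζ (slope P (Real.tanh u) (ζ u)) u) → ζ = Z P
  base : ∀ u, Z P₀ u = σ
  eventually_near : ∀ ε > 0, ∀ᶠ P in 𝓝 P₀, ∀ u, ‖Z P u - σ‖ ≤ ε

theorem exists_isProfileFamily {P₀ : Param} {σ : ℝ} (hσ : 0 < σ) (hc : |P₀.1| < 1)
    (hs : 2 * σ < P₀.2.1 * P₀.2.2.2.2.2.1) (h0 : ∀ t, riccati P₀ t σ = 0) :
    ∃ R U Z, IsProfileFamily P₀ σ R U Z := by
  obtain ⟨k, κ, r, hk, hκ, hκ1, hr, hrσ, hev⟩ := exists_lipschitz hσ hc hs h0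
  have hc0 : ∀ u, HasDerivAt (fun _ : ℝ => (σ : ℂ)) (slope P₀ (Real.tanh u) σ) u := fun u => by
    rw [slope, h0, mul_zero]
    exact hasDerivAt_const u _
  have hσre : ∀ u, σ ≤ (constB σ u).re := fun u => le_rfl
  have hfix0 : profileMap k hk P₀ (tanhB 0) (constB σ) = constB σ := by
    refine (profileMap_eq_iff hk hc hσ hσre (norm_tanhB_apply_le 0) (tanhB_apply 0)).2 fun u => ?_
    rw [add_zero]
    exact hc0 u
  have hcont : ContinuousAt (fun P : Param => ‖profileMap k hk P (tanhB 0) (constB σ) - constB σ‖)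
      P₀ := by
    have h1 := (contDiffAt_profileMap hk (P := P₀) (T := tanhB 0) (w := constB σ)
      (isUnit_one_sub_smul hc (norm_tanhB_apply_le 0)) (isUnit_reB hσ hσre)).continuousAt
    have h2 : ContinuousAt (fun P : Param => profileMap k hk P (tanhB 0) (constB σ)) P₀ :=
      h1.comp (f := fun P : Param => (P, tanhB 0, constB σ)) (by fun_prop)
    exact (h2.sub continuousAt_const).norm
  have hsmall : ∀ᶠ P in 𝓝 P₀,
      ‖profileMap k hk P (tanhB 0) (constB σ) - constB σ‖ < (1 - κ) * (r / 2) := by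
    refine hcont.eventually_lt continuousAt_const ?_
    rw [hfix0, sub_self, norm_zero]
    have : 0 < 1 - κ := sub_pos.2 hκ1
    positivity
  have hc1 : ∀ᶠ P : Param in 𝓝 P₀, |P.1| < 1 :=
    (continuous_fst.abs.continuousAt).eventually_lt continuousAt_const hc
  obtain ⟨U, hU, hUo, hU0⟩ := eventually_nhds_iff.1 ((hev.and hsmall).and hc1)
  have hadm : ∀ P ∈ U, Admissible σ k κ r P := fun P hP => ⟨(hU P hP).2, (hU P hP).1.1⟩
  choose! w hw1 hw2 hw3 using fun P (hP : P ∈ U) =>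
    exists_bounded_solution hk hκ hκ1 hr hrσ (hadm P hP) (hU P hP).1.2.le
  have hle : r / 2 ≤ r := by linarith
  have huniq : ∀ P ∈ U, ∀ ζ : ℝ → ℂ, (∀ u, ‖ζ u - σ‖ ≤ r / 2) →
      (∀ u, HasDerivAt ζ (slope P (Real.tanh u) (ζ u)) u) → ζ = w P := fun P hP ζ hζ hd =>
    eq_of_hasDerivAt_slope hk hκ hκ1 hr hrσ (hadm P hP) 0
      (fun u => mem_closedBall_iff_norm.2 ((hζ u).trans hle))
      (fun u => Metric.closedBall_subset_closedBall hle (hw1 P hP u))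
      (by simpa using hd) (by simpa using hw3 P hP)
  have hbase : ∀ u, w P₀ u = σ := fun u =>
    (congrFun (huniq P₀ hU0 (fun _ => (σ : ℂ)) (fun u => by simpa using by positivity) hc0) u).symm
  have htr := fun P₁ (hP₁ : P₁ ∈ U) => exists_contDiffAt_translates hk hκ hκ1 hr hrσ hadm
    (Z := fun P => w P) hw1 hw3 hP₁ (hUo.mem_nhds hP₁)
  refine ⟨r / 2, U, fun P => w P, hUo, hU0, by positivity, by linarith,
    fun P hP => (hU P hP).2, fun P hP u => mem_closedBall_iff_norm.1 (hw1 P hP u), hw3,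
    fun P hP => (hw2 P hP).1, fun P hP => (hw2 P hP).2, ?_, huniq, hbase, fun ε hε => ?_⟩
  · rintro ⟨P₁, τ₁⟩ ⟨hP₁, -⟩
    obtain ⟨ψ, hψ, he⟩ := htr P₁ hP₁ τ₁
    refine ContDiffAt.contDiffWithinAt ?_
    -- Evaluating the translate by `τ` at `0` gives `Z P τ`, so smoothness in `(P, τ)` is the joint
    -- smoothness sought.
    have h1 : ContDiffAt ℝ ∞ (fun x => (BoundedContinuousFunction.evalCLM ℝ (0 : ℝ)) (ψ x))
        (P₁, τ₁) := by fun_prop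
    refine h1.congr_of_eventuallyEq (he.mono fun x hx => ?_)
    simpa using (hx 0).symm
  · obtain ⟨ψ, hψ, he⟩ := htr P₀ hU0 0
    have h1 : ContinuousAt (fun P : Param => ψ (P, 0)) P₀ :=
      hψ.continuousAt.comp (f := fun P : Param => (P, (0 : ℝ))) (by fun_prop)
    have h2 : Tendsto (fun P : Param => (P, (0 : ℝ))) (𝓝 P₀) (𝓝 (P₀, 0)) :=
      Continuous.tendsto (by fun_prop) P₀
    have h3 := h2.eventually he
    have h4 : ψ (P₀, 0) = constB σ := by
      ext u
      rw [h3.self_of_nhds u]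
      exact hbase _
    filter_upwards [h3, h1.eventually (Metric.closedBall_mem_nhds _ hε)] with P hP hP' u
    rw [h4] at hP'
    have := (mem_closedBall_constB hε.le).1 hP' u
    rw [hP u] at this
    simpa using mem_closedBall_iff_norm.1 this

/-! ### Primitives and inverse functions depending on parameters -/

/-- Rescaling gives `∫₀ˣ f = ∫₀¹ x f(x t) dt`, whose domain is fixed. This is the value at `0` of a
convolution with the indicator of `(0, 1]`, and such convolutions are smooth in parameters. -/
theorem contDiffOn_primitive {E : Type*} [NormedAddCommGroup E] [NormedSpace ℝ E] {U : Set E}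
    (hU : IsOpen U) {f : E → ℝ → ℝ}
    (hf : ContDiffOn ℝ ∞ (fun x : E × ℝ => f x.1 x.2) (U ×ˢ univ)) :
    ContDiffOn ℝ ∞ (fun x : E × ℝ => ∫ v in (0 : ℝ)..x.2, f x.1 v) (U ×ˢ univ) := by
  -- The cutoff provides compact support and equals `1` on `[-2, 2]`, hence at every point `-t` with
  -- `t ∈ (0, 1]`.
  let χ : ContDiffBump (0 : ℝ) := ⟨2, 3, by norm_num, by norm_num⟩
  let g : E × ℝ → ℝ → ℝ := fun x y => χ y * (x.2 * f x.1 (-(x.2 * y)))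
  have hg : ContDiffOn ℝ ∞ ↿g ((U ×ˢ univ) ×ˢ univ) := by
    have hχ : ContDiff ℝ ∞ χ := χ.contDiff
    have h1 : ContDiffOn ℝ ∞ (fun y : (E × ℝ) × ℝ => f y.1.1 (-(y.1.2 * y.2)))
        ((U ×ˢ univ) ×ˢ univ) :=
      hf.comp (f := fun y : (E × ℝ) × ℝ => (y.1.1, -(y.1.2 * y.2))) (by fun_prop)
        fun y hy => ⟨hy.1.1, mem_univ _⟩
    have h2 : ContDiff ℝ ∞ fun y : (E × ℝ) × ℝ => χ y.2 := hχ.comp contDiff_snd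
    have h3 : ContDiff ℝ ∞ fun y : (E × ℝ) × ℝ => y.1.2 := by fun_prop
    exact h2.contDiffOn.mul (h3.contDiffOn.mul h1)
  have hconv := contDiffOn_convolution_right_with_param (μ := volume) (n := ⊤)
    (ContinuousLinearMap.mul ℝ ℝ) (g := g) (f := (Ioc (0 : ℝ) 1).indicator fun _ => (1 : ℝ))
    (hU.prod isOpen_univ) (k := tsupport χ) χ.hasCompactSupport
    (fun x y _ hy => by simp only [g, image_eq_zero_of_notMem_tsupport hy, zero_mul])
    ((integrable_indicator_iff measurableSet_Ioc).2
      (integrableOn_const (by simp))).locallyIntegrable hg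
  have hpull : ContDiffOn ℝ ∞ (fun x : E × ℝ => convolution
      ((Ioc (0 : ℝ) 1).indicator fun _ => (1 : ℝ)) (g x) (ContinuousLinearMap.mul ℝ ℝ) volume 0)
      (U ×ˢ univ) :=
    hconv.comp (f := fun x : E × ℝ => (x, (0 : ℝ))) (by fun_prop) fun x hx => ⟨hx, mem_univ _⟩
  refine hpull.congr fun x _ => ?_
  have hsc := intervalIntegral.mul_integral_comp_mul_left (a := 0) (b := 1) (f := f x.1) x.2
  rw [mul_zero, mul_one] at hsc
  rw [convolution, ← hsc, intervalIntegral.integral_of_le zero_le_one, ← integral_const_mul,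
    ← integral_indicator measurableSet_Ioc]
  congr 1
  ext t
  by_cases ht : t ∈ Ioc (0 : ℝ) 1
  · have h1 : χ (0 - t) = 1 := χ.one_of_mem_closedBall (by
      simp only [zero_sub, Metric.mem_closedBall, dist_zero_right, norm_neg, Real.norm_eq_abs]
      exact abs_le.2 ⟨by linarith [ht.1], by linarith [ht.2, show χ.rIn = 2 from rfl]⟩)
    simp only [indicator_of_mem ht, ContinuousLinearMap.mul_apply', one_mul, g, h1]
    simp
  · simp only [indicator_of_notMem ht, ContinuousLinearMap.mul_apply', zero_mul]

/-- The implicit function theorem for `X P y = ξ` gives a smooth local solution, and injectivity of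
`X P` identifies it with `Y`. -/
theorem contDiffOn_inverse {E : Type*} [NormedAddCommGroup E] [NormedSpace ℝ E] [CompleteSpace E]
    {U : Set E} (hU : IsOpen U) {X Y : E → ℝ → ℝ} {d : E → ℝ → ℝ}
    (hX : ContDiffOn ℝ ∞ (fun x : E × ℝ => X x.1 x.2) (U ×ˢ univ))
    (hd : ∀ P ∈ U, ∀ u, HasDerivAt (X P) (d P u) u) (hd0 : ∀ P ∈ U, ∀ u, d P u ≠ 0)
    (hinj : ∀ P ∈ U, Function.Injective (X P)) (hY : ∀ P ∈ U, ∀ ξ, X P (Y P ξ) = ξ) :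
    ContDiffOn ℝ ∞ (fun x : E × ℝ => Y x.1 x.2) (U ×ˢ univ) := by
  rintro ⟨P, ξ⟩ ⟨hP, -⟩
  refine ContDiffAt.contDiffWithinAt ?_
  have hf : ContDiffAt ℝ ∞ (fun y : (E × ℝ) × ℝ => X y.1.1 y.2 - y.1.2) ((P, ξ), Y P ξ) := by
    have h1 : ContDiffAt ℝ ∞ (fun x : E × ℝ => X x.1 x.2) (P, Y P ξ) :=
      hX.contDiffAt ((hU.prod isOpen_univ).mem_nhds ⟨hP, mem_univ _⟩)
    have h2 : ContDiffAt ℝ ∞ (fun y : (E × ℝ) × ℝ => X y.1.1 y.2) ((P, ξ), Y P ξ) :=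
      h1.comp ((P, ξ), Y P ξ) (f := fun y : (E × ℝ) × ℝ => (y.1.1, y.2)) (by fun_prop)
    exact h2.sub (by fun_prop)
  have hA := (hf.differentiableAt (by simp)).hasFDerivAt.comp (Y P ξ)
    (hasFDerivAt_prodMk_right (P, ξ) (Y P ξ))
  have hA' := ((hd P hP (Y P ξ)).sub_const ξ).hasFDerivAt.unique hA
  have hinv : (fderiv ℝ (fun y : (E × ℝ) × ℝ => X y.1.1 y.2 - y.1.2) ((P, ξ), Y P ξ) ∘L
      ContinuousLinearMap.inr ℝ (E × ℝ) ℝ).IsInvertible := by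
    rw [← hA']
    refine ⟨ContinuousLinearEquiv.unitsEquivAut ℝ (Units.mk0 _ (hd0 P hP (Y P ξ))), ?_⟩
    ext
    simp
  refine (hf.contDiffAt_implicitFunction (by simp) hinv).congr_of_eventuallyEq ?_
  have hev : ∀ᶠ x : E × ℝ in 𝓝 (P, ξ), x.1 ∈ U := continuousAt_fst.eventually (hU.mem_nhds hP)
  filter_upwards [hf.eventually_apply_implicitFunction (by simp) hinv, hev] with x hx hxU
  refine hinj _ hxU ?_
  rw [hY P hP, sub_self] at hx
  rw [hY _ hxU]
  linarith

theorem bijective_of_le_deriv {X d : ℝ → ℝ} {δ : ℝ} (hδ : 0 < δ)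
    (hX : ∀ u, HasDerivAt X (d u) u) (hd : ∀ u, δ ≤ d u) : Function.Bijective X := by
  have hdiff : Differentiable ℝ X := fun u => (hX u).differentiableAt
  have hle : ∀ x y, x ≤ y → δ * (y - x) ≤ X y - X x := fun x y hxy =>
    mul_sub_le_image_sub_of_le_deriv hdiff (fun u => by rw [(hX u).deriv]; exact hd u) hxy
  refine ⟨(strictMono_of_deriv_pos fun u => by
    rw [(hX u).deriv]; exact hδ.trans_le (hd u)).injective, hdiff.continuous.surjective ?_ ?_⟩
  · refine tendsto_atTop_mono' _ ?_ (tendsto_atTop_add_const_right _ (X 0)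
      (tendsto_id.const_mul_atTop hδ))
    filter_upwards [eventually_ge_atTop 0] with u hu
    have := hle 0 u hu
    simp only [id, sub_zero] at *
    linarith
  · refine tendsto_atBot_mono' _ ?_ (tendsto_atBot_add_const_right _ (X 0)
      (tendsto_id.const_mul_atBot hδ))
    filter_upwards [eventually_le_atBot 0] with u hu
    have := hle u 0 hu
    simp only [id] at *
    linarith

/-! ### The profile equations -/

theorem riccati_eq (c α β h μ s Ω t p q : ℝ) :
    riccati (c, α, β, h, μ, s, Ω) t (p + q * Complex.I) =
      (t * (p ^ 2 - q ^ 2 + μ) - α * s * p + s * q + h - Ω : ℝ) +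
        (2 * t * p * q - α * s * q - s * p - β / (1 - c * t) + α * Ω : ℝ) * Complex.I := by
  simp only [riccati]
  push_cast
  rw [div_eq_mul_inv]
  linear_combination (t * q ^ 2 - s * q : ℂ) * Complex.I_sq

theorem riccati_re (c α β h μ s Ω t p q : ℝ) :
    (riccati (c, α, β, h, μ, s, Ω) t (p + q * Complex.I)).re =
      t * (p ^ 2 - q ^ 2 + μ) - α * s * p + s * q + h - Ω := by
  rw [riccati_eq]
  simp only [Complex.add_re, Complex.re_ofReal_mul, Complex.ofReal_re, Complex.I_re, mul_zero,
    add_zero]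

theorem riccati_im (c α β h μ s Ω t p q : ℝ) :
    (riccati (c, α, β, h, μ, s, Ω) t (p + q * Complex.I)).im =
      2 * t * p * q - α * s * q - s * p - β / (1 - c * t) + α * Ω := by
  rw [riccati_eq]
  simp only [Complex.add_im, Complex.im_ofReal_mul, Complex.ofReal_im, Complex.I_im, mul_one,
    zero_add]

section Derivatives

variable {s Ω : ℝ} {θ φ θ₁ θ₂ φ₁ φ₂ : ℝ → ℝ}

theorem hasDerivAt_vec3 {f₀ f₁ f₂ : ℝ → ℝ} {a₀ a₁ a₂ x : ℝ} (h₀ : HasDerivAt f₀ a₀ x)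
    (h₁ : HasDerivAt f₁ a₁ x) (h₂ : HasDerivAt f₂ a₂ x) :
    HasDerivAt (fun y => ![f₀ y, f₁ y, f₂ y]) ![a₀, a₁, a₂] x := by
  refine hasDerivAt_pi.2 fun i => ?_
  fin_cases i
  · exact h₀
  · exact h₁
  · exact h₂

theorem hasDerivAt_magnetization_time (hθ : ∀ ξ, HasDerivAt θ (θ₁ ξ) ξ)
    (hφ : ∀ ξ, HasDerivAt φ (φ₁ ξ) ξ) (x t : ℝ) :
    HasDerivAt (fun τ => magnetization s Ω θ φ x τ)
      ![-Real.sin (φ (x - s * t) + Ω * t) * (Ω - s * φ₁ (x - s * t)) * Real.sin (θ (x - s * t)) -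
          s * Real.cos (φ (x - s * t) + Ω * t) * Real.cos (θ (x - s * t)) * θ₁ (x - s * t),
        Real.cos (φ (x - s * t) + Ω * t) * (Ω - s * φ₁ (x - s * t)) * Real.sin (θ (x - s * t)) -
          s * Real.sin (φ (x - s * t) + Ω * t) * Real.cos (θ (x - s * t)) * θ₁ (x - s * t),
        s * Real.sin (θ (x - s * t)) * θ₁ (x - s * t)] t := by
  have hξ : HasDerivAt (fun τ => x - s * τ) (-s) t := by
    simpa using ((hasDerivAt_id t).const_mul s).const_sub x
  have h1 : HasDerivAt (fun τ => θ (x - s * τ)) (θ₁ (x - s * t) * -s) t := (hθ _).comp t hξ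
  have h2 : HasDerivAt (fun τ => φ (x - s * τ) + Ω * τ) (φ₁ (x - s * t) * -s + Ω) t :=
    (((hφ _).comp t hξ).add ((hasDerivAt_id t).const_mul Ω)).congr_deriv (by ring)
  refine hasDerivAt_vec3 ((h2.cos.mul h1.sin).congr_deriv ?_)
    ((h2.sin.mul h1.sin).congr_deriv ?_) (h1.cos.congr_deriv ?_) <;> ring

theorem hasDerivAt_magnetization_space (hθ : ∀ ξ, HasDerivAt θ (θ₁ ξ) ξ)
    (hφ : ∀ ξ, HasDerivAt φ (φ₁ ξ) ξ) (x t : ℝ) :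
    HasDerivAt (fun y => magnetization s Ω θ φ y t)
      ![-Real.sin (φ (x - s * t) + Ω * t) * φ₁ (x - s * t) * Real.sin (θ (x - s * t)) +
          Real.cos (φ (x - s * t) + Ω * t) * (Real.cos (θ (x - s * t)) * θ₁ (x - s * t)),
        Real.cos (φ (x - s * t) + Ω * t) * φ₁ (x - s * t) * Real.sin (θ (x - s * t)) +
          Real.sin (φ (x - s * t) + Ω * t) * (Real.cos (θ (x - s * t)) * θ₁ (x - s * t)),
        -Real.sin (θ (x - s * t)) * θ₁ (x - s * t)] x := by
  have h1 : HasDerivAt (fun y => θ (y - s * t)) (θ₁ (x - s * t)) x :=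
    (hθ _).comp_sub_const x (s * t)
  have h2 : HasDerivAt (fun y => φ (y - s * t) + Ω * t) (φ₁ (x - s * t)) x :=
    ((hφ _).comp_sub_const x (s * t)).add_const (Ω * t)
  exact hasDerivAt_vec3 (h2.cos.mul h1.sin) (h2.sin.mul h1.sin) h1.cos

theorem hasDerivAt_deriv_magnetization (hθ : ∀ ξ, HasDerivAt θ (θ₁ ξ) ξ)
    (hφ : ∀ ξ, HasDerivAt φ (φ₁ ξ) ξ) (hθ₁ : ∀ ξ, HasDerivAt θ₁ (θ₂ ξ) ξ)
    (hφ₁ : ∀ ξ, HasDerivAt φ₁ (φ₂ ξ) ξ) (x t : ℝ) {C S c d : ℝ}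
    (hC : Real.cos (θ (x - s * t)) = C) (hS : Real.sin (θ (x - s * t)) = S)
    (hc : Real.cos (φ (x - s * t) + Ω * t) = c) (hd : Real.sin (φ (x - s * t) + Ω * t) = d) :
    HasDerivAt (fun y => deriv (fun z => magnetization s Ω θ φ z t) y)
      ![-c * φ₁ (x - s * t) ^ 2 * S - d * φ₂ (x - s * t) * S -
          2 * d * φ₁ (x - s * t) * C * θ₁ (x - s * t) - c * S * θ₁ (x - s * t) ^ 2 +
          c * C * θ₂ (x - s * t),
        -d * φ₁ (x - s * t) ^ 2 * S + c * φ₂ (x - s * t) * S +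
          2 * c * φ₁ (x - s * t) * C * θ₁ (x - s * t) - d * S * θ₁ (x - s * t) ^ 2 +
          d * C * θ₂ (x - s * t),
        -C * θ₁ (x - s * t) ^ 2 - S * θ₂ (x - s * t)] x := by
  have h1 : HasDerivAt (fun y => θ (y - s * t)) (θ₁ (x - s * t)) x :=
    (hθ _).comp_sub_const x (s * t)
  have h2 : HasDerivAt (fun y => φ (y - s * t) + Ω * t) (φ₁ (x - s * t)) x :=
    ((hφ _).comp_sub_const x (s * t)).add_const (Ω * t)
  have h3 : HasDerivAt (fun y => θ₁ (y - s * t)) (θ₂ (x - s * t)) x :=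
    (hθ₁ _).comp_sub_const x (s * t)
  have h4 : HasDerivAt (fun y => φ₁ (y - s * t)) (φ₂ (x - s * t)) x :=
    (hφ₁ _).comp_sub_const x (s * t)
  have e : (fun y => deriv (fun z => magnetization s Ω θ φ z t) y) = _ :=
    funext fun y => (hasDerivAt_magnetization_space hθ hφ y t).deriv
  rw [e]
  refine hasDerivAt_vec3
    ((((h2.sin.neg.mul h4).mul h1.sin).add (h2.cos.mul (h1.cos.mul h3))).congr_deriv ?_)
    ((((h2.cos.mul h4).mul h1.sin).add (h2.sin.mul (h1.cos.mul h3))).congr_deriv ?_)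
    ((h1.sin.neg.mul h3).congr_deriv ?_) <;>
  simp only [hC, hS, hc, hd, Pi.neg_apply, Pi.mul_apply] <;> ring

end Derivatives

/-- The residual of the equation is tangent to the sphere: it is `sin θ` times `R₁ e_θ + R₂ e_φ` in
the spherical frame. As `sin θ ≠ 0`, it vanishes exactly when `R₁ = R₂ = 0`, the imaginary and real
parts of the Riccati equation. -/
theorem eqn_iff_profile {c α β h μ s Ω : ℝ} {θ φ p q p₁ q₁ : ℝ → ℝ}
    (hθ : ∀ ξ, HasDerivAt θ (p ξ * Real.sin (θ ξ)) ξ) (hφ : ∀ ξ, HasDerivAt φ (q ξ) ξ)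
    (hp : ∀ ξ, HasDerivAt p (p₁ ξ) ξ) (hq : ∀ ξ, HasDerivAt q (q₁ ξ) ξ)
    (hS : ∀ ξ, Real.sin (θ ξ) ≠ 0) :
    (∀ x t, deriv (fun τ => magnetization s Ω θ φ x τ) t -
        α • (magnetization s Ω θ φ x t ⨯₃ deriv (fun τ => magnetization s Ω θ φ x τ) t) =
      -(magnetization s Ω θ φ x t ⨯₃ effectiveField h μ (magnetization s Ω θ φ) x t) +
        magnetization s Ω θ φ x t ⨯₃
          (magnetization s Ω θ φ x t ⨯₃ currentTerm c β (magnetization s Ω θ φ x t))) ↔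
    ∀ ξ, (p₁ ξ + q₁ ξ * Complex.I : ℂ) =
      riccati (c, α, β, h, μ, s, Ω) (-Real.cos (θ ξ)) (p ξ + q ξ * Complex.I) := by
  have hθ₁ : ∀ ξ, HasDerivAt (fun ξ => p ξ * Real.sin (θ ξ))
      (p₁ ξ * Real.sin (θ ξ) + p ξ * (Real.cos (θ ξ) * (p ξ * Real.sin (θ ξ)))) ξ :=
    fun ξ => (hp ξ).mul (hθ ξ).sin
  set R₁ : ℝ → ℝ := fun ξ => -s * p ξ + α * (Ω - s * q ξ) -
    (q₁ ξ + 2 * Real.cos (θ ξ) * p ξ * q ξ + β / (1 + c * Real.cos (θ ξ))) with hR₁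
  set R₂ : ℝ → ℝ := fun ξ => Ω - s * q ξ + α * s * p ξ +
    (p₁ ξ + p ξ ^ 2 * Real.cos (θ ξ) - Real.cos (θ ξ) * q ξ ^ 2 - (h - μ * Real.cos (θ ξ))) with hR₂
  have hpt : ∀ x t, (deriv (fun τ => magnetization s Ω θ φ x τ) t -
        α • (magnetization s Ω θ φ x t ⨯₃ deriv (fun τ => magnetization s Ω θ φ x τ) t)) -
      (-(magnetization s Ω θ φ x t ⨯₃ effectiveField h μ (magnetization s Ω θ φ) x t) +
        magnetization s Ω θ φ x t ⨯₃
          (magnetization s Ω θ φ x t ⨯₃ currentTerm c β (magnetization s Ω θ φ x t))) =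
      Real.sin (θ (x - s * t)) •
        ![R₁ (x - s * t) * (Real.cos (φ (x - s * t) + Ω * t) * Real.cos (θ (x - s * t))) -
            R₂ (x - s * t) * Real.sin (φ (x - s * t) + Ω * t),
          R₁ (x - s * t) * (Real.sin (φ (x - s * t) + Ω * t) * Real.cos (θ (x - s * t))) +
            R₂ (x - s * t) * Real.cos (φ (x - s * t) + Ω * t),
          -(R₁ (x - s * t) * Real.sin (θ (x - s * t)))] := by
    intro x t
    rw [effectiveField, (hasDerivAt_magnetization_time hθ hφ x t).deriv,
      (hasDerivAt_deriv_magnetization hθ hφ hθ₁ hq x t rfl rfl rfl rfl).deriv]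
    have e1 := Real.sin_sq_add_cos_sq (θ (x - s * t))
    have e2 := Real.sin_sq_add_cos_sq (φ (x - s * t) + Ω * t)
    simp only [magnetization, currentTerm, e3, hR₁, hR₂]
    generalize Real.sin (θ (x - s * t)) = S at *
    generalize Real.cos (θ (x - s * t)) = C at *
    generalize Real.sin (φ (x - s * t) + Ω * t) = b at *
    generalize Real.cos (φ (x - s * t) + Ω * t) = a at *
    generalize p (x - s * t) = p at *
    generalize q (x - s * t) = q at *
    generalize p₁ (x - s * t) = p₁ at *
    generalize q₁ (x - s * t) = q₁ at *
    simp only [Matrix.cons_val]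
    generalize β / (1 + c * C) = J at *
    ext i
    fin_cases i
    · simp [cross_apply]
      linear_combination (-(α * s * p + p₁ + p ^ 2 * C) * b * S) * e1
    · simp [cross_apply]
      linear_combination ((α * s * p + p₁ + p ^ 2 * C) * a * S) * e1
    · simp [cross_apply]
      linear_combination
        (S ^ 2 * (-(α * (Ω - s * q)) + q₁ + 2 * q * C * p + J)) * e2
  have hcx : ∀ ξ, (p₁ ξ + q₁ ξ * Complex.I : ℂ) =
      riccati (c, α, β, h, μ, s, Ω) (-Real.cos (θ ξ)) (p ξ + q ξ * Complex.I) ↔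
      R₁ ξ = 0 ∧ R₂ ξ = 0 := fun ξ => by
    rw [Complex.ext_iff, riccati_re, riccati_im]
    simp only [Complex.add_re, Complex.re_ofReal_mul, Complex.ofReal_re, Complex.I_re, mul_zero,
      add_zero, Complex.add_im, Complex.im_ofReal_mul, Complex.ofReal_im, Complex.I_im, mul_one,
      zero_add, hR₁, hR₂, mul_neg, sub_neg_eq_add]
    constructor
    · rintro ⟨h1, h2⟩
      exact ⟨by rw [h2]; ring, by rw [h1]; ring⟩
    · rintro ⟨h1, h2⟩
      exact ⟨by linear_combination h2, by linear_combination -h1⟩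
  simp only [hcx]
  constructor
  · intro heq ξ
    have h0 := (hpt ξ 0).symm.trans (sub_eq_zero.2 (heq ξ 0))
    simp only [mul_zero, sub_zero, add_zero] at h0
    have h1 := (smul_eq_zero.1 h0).resolve_left (hS ξ)
    have c0 := congrFun h1 0
    have c1 := congrFun h1 1
    have c2 := congrFun h1 2
    simp only [Matrix.cons_val, Pi.zero_apply, neg_eq_zero, mul_eq_zero, hS ξ, or_false] at c0 c1 c2
    refine ⟨c2, ?_⟩
    rw [c2] at c0 c1
    have e2 := Real.sin_sq_add_cos_sq (φ ξ)
    -- Projection onto `e_φ = (-sin φ, cos φ, 0)`.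
    linear_combination (-Real.sin (φ ξ)) * c0 + Real.cos (φ ξ) * c1 - R₂ ξ * e2
  · intro hR x t
    rw [← sub_eq_zero, hpt, (hR _).1, (hR _).2]
    ext i
    fin_cases i <;> simp

theorem contDiff_magnetization {s Ω : ℝ} {θ φ : ℝ → ℝ} (hθ : ContDiff ℝ 2 θ)
    (hφ : ContDiff ℝ 2 φ) : ContDiff ℝ 2 (fun z : ℝ × ℝ => magnetization s Ω θ φ z.1 z.2) := by
  refine contDiff_pi.2 fun i => ?_
  fin_cases i <;> simp [magnetization] <;> fun_prop

theorem magnetization_dotProduct_self (s Ω : ℝ) (θ φ : ℝ → ℝ) (x t : ℝ) :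
    magnetization s Ω θ φ x t ⬝ᵥ magnetization s Ω θ φ x t = 1 := by
  have e1 := Real.sin_sq_add_cos_sq (θ (x - s * t))
  have e2 := Real.sin_sq_add_cos_sq (φ (x - s * t) + Ω * t)
  simp only [magnetization, dotProduct, Fin.sum_univ_three, Matrix.cons_val]
  linear_combination e1 + Real.sin (θ (x - s * t)) ^ 2 * e2

/-! ### The angle as a function of `u = log tan (θ / 2)` -/

/-- The polar angle with `log tan (θ / 2) = u`. -/
def angle (u : ℝ) : ℝ := 2 * Real.arctan (Real.exp u)

theorem cos_angle (u : ℝ) : Real.cos (angle u) = -Real.tanh u := by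
  rw [angle, Real.cos_two_mul, Real.cos_sq_arctan, Real.tanh_eq, Real.exp_neg]
  have := (Real.exp_pos u).ne'
  field_simp
  ring

theorem sin_angle (u : ℝ) : Real.sin (angle u) = 2 * Real.exp u / (1 + Real.exp u ^ 2) := by
  have h1 : Real.cos (Real.arctan (Real.exp u)) ≠ 0 := (Real.cos_arctan_pos _).ne'
  have h2 : Real.sin (Real.arctan (Real.exp u)) =
      Real.exp u * Real.cos (Real.arctan (Real.exp u)) := by
    rw [← Real.tan_mul_cos h1, Real.tan_arctan]
  rw [angle, Real.sin_two_mul, h2]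
  linear_combination 2 * Real.exp u * Real.cos_sq_arctan (Real.exp u)

theorem hasDerivAt_angle (u : ℝ) : HasDerivAt angle (Real.sin (angle u)) u := by
  rw [sin_angle]
  refine ((Real.hasDerivAt_exp u).arctan.const_mul 2).congr_deriv ?_
  ring

theorem contDiff_angle : ContDiff ℝ ∞ angle :=
  contDiff_const.mul (Real.contDiff_arctan.comp Real.contDiff_exp)

theorem angle_mem (u : ℝ) : angle u ∈ Ioo 0 Real.pi := by
  have h1 := Real.arctan_pos.2 (Real.exp_pos u)
  have h2 := Real.arctan_lt_pi_div_two (Real.exp u)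
  constructor <;> unfold angle <;> linarith

theorem sin_angle_pos (u : ℝ) : 0 < Real.sin (angle u) :=
  Real.sin_pos_of_mem_Ioo (angle_mem u)

theorem tendsto_angle_atTop : Tendsto angle atTop (𝓝 Real.pi) := by
  have := ((Real.tendsto_arctan_atTop.mono_right nhdsWithin_le_nhds).comp
    Real.tendsto_exp_atTop).const_mul 2
  rwa [mul_div_cancel₀ _ two_ne_zero] at this

theorem tendsto_angle_atBot : Tendsto angle atBot (𝓝 0) := by
  have := ((Real.continuous_arctan.tendsto 0).comp Real.tendsto_exp_atBot).const_mul 2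
  rwa [Real.arctan_zero, mul_zero] at this

theorem angle_log_tan {x : ℝ} (hx : x ∈ Ioo 0 Real.pi) :
    angle (Real.log (Real.tan (x / 2))) = x := by
  have h : 0 < Real.tan (x / 2) :=
    Real.tan_pos_of_pos_of_lt_pi_div_two (by linarith [hx.1]) (by linarith [hx.2])
  rw [angle, Real.exp_log h, Real.arctan_tan (by linarith [hx.1, Real.pi_pos]) (by linarith [hx.2])]
  ring

theorem hasDerivAt_log_tan {θ : ℝ → ℝ} {θ₁ ξ : ℝ} (hθ : HasDerivAt θ θ₁ ξ)
    (hmem : θ ξ ∈ Ioo 0 Real.pi) :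
    HasDerivAt (fun ξ => Real.log (Real.tan (θ ξ / 2))) (θ₁ / Real.sin (θ ξ)) ξ := by
  have hs : 0 < Real.sin (θ ξ / 2) :=
    Real.sin_pos_of_mem_Ioo ⟨by linarith [hmem.1], by linarith [hmem.1, hmem.2]⟩
  have hc : 0 < Real.cos (θ ξ / 2) :=
    Real.cos_pos_of_mem_Ioo ⟨by linarith [hmem.1, Real.pi_pos], by linarith [hmem.2]⟩
  have h2 : Real.sin (θ ξ) = 2 * Real.sin (θ ξ / 2) * Real.cos (θ ξ / 2) := by
    rw [← Real.sin_two_mul]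
    congr 1
    ring
  have ht : Real.tan (θ ξ / 2) ≠ 0 := by
    rw [Real.tan_eq_sin_div_cos]
    positivity
  have h3 : HasDerivAt (fun ξ => Real.tan (θ ξ / 2)) (1 / Real.cos (θ ξ / 2) ^ 2 * (θ₁ / 2)) ξ :=
    (Real.hasDerivAt_tan hc.ne').comp ξ (h := fun ξ => θ ξ / 2) (hθ.div_const 2)
  refine (h3.log ht).congr_deriv ?_
  rw [h2, Real.tan_eq_sin_div_cos]
  field_simp

/-! ### The walls determined by a profile family -/

/-- The space variable as a function of `u = log tan (θ / 2)`. -/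
def position (Z : Param → ℝ → ℂ) (P : Param) (u : ℝ) : ℝ := ∫ v in (0 : ℝ)..u, ((Z P v).re)⁻¹

/-- The azimuth as a function of `u = log tan (θ / 2)`. -/
def azimuth (Z : Param → ℝ → ℂ) (P : Param) (u : ℝ) : ℝ :=
  ∫ v in (0 : ℝ)..u, (Z P v).im * ((Z P v).re)⁻¹

/-- `u = log tan (θ / 2)` as a function of the space variable. -/
def logTan (Z : Param → ℝ → ℂ) (P : Param) : ℝ → ℝ := Function.invFun (position Z P)

/-- The polar angle of the wall. -/
def wallPolar (Z : Param → ℝ → ℂ) (P : Param) (ξ : ℝ) : ℝ := angle (logTan Z P ξ)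

/-- The azimuthal angle of the wall. -/
def wallAzimuth (Z : Param → ℝ → ℂ) (P : Param) (ξ : ℝ) : ℝ := azimuth Z P (logTan Z P ξ)

namespace IsProfileFamily

variable {P₀ P : Param} {σ R : ℝ} {U : Set Param} {Z : Param → ℝ → ℂ}

theorem mono (hF : IsProfileFamily P₀ σ R U Z) {V : Set Param} (hV : IsOpen V) (hVU : V ⊆ U)
    (h0 : P₀ ∈ V) : IsProfileFamily P₀ σ R V Z where
  isOpen := hV
  mem := h0
  pos := hF.pos
  lt := hF.lt
  abs_lt P hP := hF.abs_lt P (hVU hP)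
  near P hP := hF.near P (hVU hP)
  hasDerivAt P hP := hF.hasDerivAt P (hVU hP)
  tendsto_atBot P hP := hF.tendsto_atBot P (hVU hP)
  tendsto_atTop P hP := hF.tendsto_atTop P (hVU hP)
  contDiffOn := hF.contDiffOn.mono (prod_mono hVU subset_rfl)
  unique P hP := hF.unique P (hVU hP)
  base := hF.base
  eventually_near := hF.eventually_near

theorem le_re (hF : IsProfileFamily P₀ σ R U Z) (hP : P ∈ U) (u : ℝ) : σ - R ≤ (Z P u).re :=
  le_re_of_mem_closedBall (mem_closedBall_iff_norm.2 (hF.near P hP u))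

theorem re_pos (hF : IsProfileFamily P₀ σ R U Z) (hP : P ∈ U) (u : ℝ) : 0 < (Z P u).re :=
  (sub_pos.2 hF.lt).trans_le (hF.le_re hP u)

theorem re_le (hF : IsProfileFamily P₀ σ R U Z) (hP : P ∈ U) (u : ℝ) : (Z P u).re ≤ σ + R := by
  have h := (Complex.abs_re_le_norm (Z P u - σ)).trans (hF.near P hP u)
  rw [Complex.sub_re, Complex.ofReal_re] at h
  linarith [(abs_le.1 h).2]

theorem continuous (hF : IsProfileFamily P₀ σ R U Z) (hP : P ∈ U) : Continuous (Z P) :=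
  continuous_iff_continuousAt.2 fun u => (hF.hasDerivAt P hP u).continuousAt

theorem continuous_inv_re (hF : IsProfileFamily P₀ σ R U Z) (hP : P ∈ U) :
    Continuous fun v => ((Z P v).re)⁻¹ :=
  (Complex.continuous_re.comp (hF.continuous hP)).inv₀ fun u => (hF.re_pos hP u).ne'

theorem hasDerivAt_position (hF : IsProfileFamily P₀ σ R U Z) (hP : P ∈ U) (u : ℝ) :
    HasDerivAt (position Z P) ((Z P u).re)⁻¹ u :=
  (hF.continuous_inv_re hP).integral_hasStrictDerivAt 0 u |>.hasDerivAt

theorem hasDerivAt_azimuth (hF : IsProfileFamily P₀ σ R U Z) (hP : P ∈ U) (u : ℝ) :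
    HasDerivAt (azimuth Z P) ((Z P u).im * ((Z P u).re)⁻¹) u :=
  ((Complex.continuous_im.comp (hF.continuous hP)).mul
    (hF.continuous_inv_re hP)).integral_hasStrictDerivAt 0 u |>.hasDerivAt

theorem bijective_position (hF : IsProfileFamily P₀ σ R U Z) (hP : P ∈ U) :
    Function.Bijective (position Z P) := by
  have hpos : 0 < σ + R := by linarith [hF.pos, hF.lt]
  exact bijective_of_le_deriv (inv_pos.2 hpos) (hF.hasDerivAt_position hP)
    fun u => inv_anti₀ (hF.re_pos hP u) (hF.re_le hP u)

theorem position_logTan (hF : IsProfileFamily P₀ σ R U Z) (hP : P ∈ U) (ξ : ℝ) :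
    position Z P (logTan Z P ξ) = ξ :=
  Function.rightInverse_invFun (hF.bijective_position hP).2 ξ

theorem logTan_position (hF : IsProfileFamily P₀ σ R U Z) (hP : P ∈ U) (u : ℝ) :
    logTan Z P (position Z P u) = u :=
  Function.leftInverse_invFun (hF.bijective_position hP).1 u

theorem contDiffOn_inv_re (hF : IsProfileFamily P₀ σ R U Z) :
    ContDiffOn ℝ ∞ (fun x : Param × ℝ => ((Z x.1 x.2).re)⁻¹) (U ×ˢ univ) :=
  (Complex.reCLM.contDiff.comp_contDiffOn hF.contDiffOn).inv fun _ hx => (hF.re_pos hx.1 _).ne'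

theorem contDiffOn_logTan (hF : IsProfileFamily P₀ σ R U Z) :
    ContDiffOn ℝ ∞ (fun x : Param × ℝ => logTan Z x.1 x.2) (U ×ˢ univ) :=
  contDiffOn_inverse hF.isOpen (contDiffOn_primitive hF.isOpen (f := fun P v => ((Z P v).re)⁻¹)
      hF.contDiffOn_inv_re)
    (fun _ hP u => hF.hasDerivAt_position hP u) (fun _ hP u => (inv_pos.2 (hF.re_pos hP u)).ne')
    (fun _ hP => (hF.bijective_position hP).1) fun _ hP ξ => hF.position_logTan hP ξ

theorem contDiffOn_wallPolar (hF : IsProfileFamily P₀ σ R U Z) :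
    ContDiffOn ℝ ∞ (fun x : Param × ℝ => wallPolar Z x.1 x.2) (U ×ˢ univ) :=
  contDiff_angle.comp_contDiffOn hF.contDiffOn_logTan

theorem contDiffOn_wallAzimuth (hF : IsProfileFamily P₀ σ R U Z) :
    ContDiffOn ℝ ∞ (fun x : Param × ℝ => wallAzimuth Z x.1 x.2) (U ×ˢ univ) := by
  have h : ContDiffOn ℝ ∞ (fun x : Param × ℝ => azimuth Z x.1 x.2) (U ×ˢ univ) :=
    contDiffOn_primitive hF.isOpen (f := fun P v => (Z P v).im * ((Z P v).re)⁻¹)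
      ((Complex.imCLM.contDiff.comp_contDiffOn hF.contDiffOn).mul hF.contDiffOn_inv_re)
  exact h.comp (f := fun x : Param × ℝ => (x.1, logTan Z x.1 x.2))
    (contDiff_fst.contDiffOn.prodMk hF.contDiffOn_logTan) fun x hx => ⟨hx.1, mem_univ _⟩

theorem contDiff_section {f : Param → ℝ → ℝ} (hP : P ∈ U)
    (hf : ContDiffOn ℝ ∞ (fun x : Param × ℝ => f x.1 x.2) (U ×ˢ univ)) : ContDiff ℝ ∞ (f P) :=
  contDiffOn_univ.1 (hf.comp (f := fun ξ : ℝ => (P, ξ)) (by fun_prop)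
    fun _ _ => ⟨hP, mem_univ _⟩)

theorem hasDerivAt_logTan (hF : IsProfileFamily P₀ σ R U Z) (hP : P ∈ U) (ξ : ℝ) :
    HasDerivAt (logTan Z P) (Z P (logTan Z P ξ)).re ξ := by
  have h := HasDerivAt.of_local_left_inverse
    (contDiff_section hP hF.contDiffOn_logTan).continuous.continuousAt
    (hF.hasDerivAt_position hP (logTan Z P ξ)) (inv_pos.2 (hF.re_pos hP _)).ne'
    (Eventually.of_forall (hF.position_logTan hP))
  rwa [inv_inv] at h

theorem hasDerivAt_wallPolar (hF : IsProfileFamily P₀ σ R U Z) (hP : P ∈ U) (ξ : ℝ) :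
    HasDerivAt (wallPolar Z P) ((Z P (logTan Z P ξ)).re * Real.sin (wallPolar Z P ξ)) ξ :=
  ((hasDerivAt_angle _).comp ξ (hF.hasDerivAt_logTan hP ξ)).congr_deriv (mul_comm _ _)

theorem hasDerivAt_wallAzimuth (hF : IsProfileFamily P₀ σ R U Z) (hP : P ∈ U) (ξ : ℝ) :
    HasDerivAt (wallAzimuth Z P) (Z P (logTan Z P ξ)).im ξ := by
  refine ((hF.hasDerivAt_azimuth hP _).comp ξ (hF.hasDerivAt_logTan hP ξ)).congr_deriv ?_
  rw [mul_assoc, inv_mul_cancel₀ (hF.re_pos hP _).ne', mul_one]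

theorem hasDerivAt_comp_logTan (hF : IsProfileFamily P₀ σ R U Z) (hP : P ∈ U) (ξ : ℝ) :
    HasDerivAt (fun ξ => Z P (logTan Z P ξ))
      (riccati P (Real.tanh (logTan Z P ξ)) (Z P (logTan Z P ξ))) ξ := by
  refine ((hF.hasDerivAt P hP _).scomp ξ (hF.hasDerivAt_logTan hP ξ)).congr_deriv ?_
  rw [slope, Complex.real_smul, mul_inv_cancel_left₀]
  exact Complex.ofReal_ne_zero.2 (hF.re_pos hP _).ne'

theorem monotone_logTan (hF : IsProfileFamily P₀ σ R U Z) (hP : P ∈ U) : Monotone (logTan Z P) :=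
  monotone_of_hasDerivAt_nonneg (hF.hasDerivAt_logTan hP) fun _ => (hF.re_pos hP _).le

theorem tendsto_logTan_atTop (hF : IsProfileFamily P₀ σ R U Z) (hP : P ∈ U) :
    Tendsto (logTan Z P) atTop atTop :=
  (hF.monotone_logTan hP).tendsto_atTop_atTop fun b => ⟨_, (hF.logTan_position hP b).ge⟩

theorem tendsto_logTan_atBot (hF : IsProfileFamily P₀ σ R U Z) (hP : P ∈ U) :
    Tendsto (logTan Z P) atBot atBot :=
  (hF.monotone_logTan hP).tendsto_atBot_atBot fun b => ⟨_, (hF.logTan_position hP b).le⟩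

theorem deriv_wallAzimuth (hF : IsProfileFamily P₀ σ R U Z) (hP : P ∈ U) :
    deriv (wallAzimuth Z P) = fun ξ => (Z P (logTan Z P ξ)).im :=
  funext fun ξ => (hF.hasDerivAt_wallAzimuth hP ξ).deriv

theorem phaseCurve_eq (hF : IsProfileFamily P₀ σ R U Z) (hP : P ∈ U) (ξ : ℝ) :
    phaseCurve (wallPolar Z P) (wallAzimuth Z P) ξ =
      (angle (logTan Z P ξ), (Z P (logTan Z P ξ)).re, (Z P (logTan Z P ξ)).im) := by
  have : Real.sin (wallPolar Z P ξ) ≠ 0 := (sin_angle_pos _).ne'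
  rw [phaseCurve, hF.deriv_wallAzimuth hP, (hF.hasDerivAt_wallPolar hP ξ).deriv,
    mul_div_cancel_right₀ _ this]
  rfl

theorem isDomainWall {c α β h μ s Ω : ℝ} (hF : IsProfileFamily P₀ σ R U Z)
    (hP : (c, α, β, h, μ, s, Ω) ∈ U) :
    IsDomainWall c α β h μ s Ω (wallPolar Z (c, α, β, h, μ, s, Ω))
      (wallAzimuth Z (c, α, β, h, μ, s, Ω)) := by
  have hθ := contDiff_infty.1 (contDiff_section hP hF.contDiffOn_wallPolar) 2
  have hφ := contDiff_infty.1 (contDiff_section hP hF.contDiffOn_wallAzimuth) 2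
  refine ⟨hθ, hφ, fun ξ => angle_mem _,
    Or.inl ⟨tendsto_angle_atBot.comp (hF.tendsto_logTan_atBot hP),
      tendsto_angle_atTop.comp (hF.tendsto_logTan_atTop hP)⟩,
    contDiff_magnetization hθ hφ, magnetization_dotProduct_self _ _ _ _, ?_⟩
  have hz := hF.hasDerivAt_comp_logTan hP
  refine (eqn_iff_profile (hF.hasDerivAt_wallPolar hP) (hF.hasDerivAt_wallAzimuth hP)
    (fun ξ => Complex.reCLM.hasFDerivAt.comp_hasDerivAt ξ (hz ξ))
    (fun ξ => Complex.imCLM.hasFDerivAt.comp_hasDerivAt ξ (hz ξ))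
    fun ξ => (sin_angle_pos _).ne').2 fun ξ => ?_
  rw [wallPolar, cos_angle, neg_neg, Complex.re_add_im]
  exact Complex.re_add_im _

theorem isFlat (hF : IsProfileFamily P₀ σ R U Z) (hP : P ∈ U) : IsFlat (wallAzimuth Z P) := by
  rw [IsFlat, hF.deriv_wallAzimuth hP]
  obtain ⟨a, ha⟩ := hF.tendsto_atBot P hP
  obtain ⟨b, hb⟩ := hF.tendsto_atTop P hP
  exact ⟨Or.inl ⟨_, (((Complex.continuous_im.tendsto a).comp ha).comp
      (hF.tendsto_logTan_atBot hP)).abs⟩,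
    Or.inl ⟨_, (((Complex.continuous_im.tendsto b).comp hb).comp
      (hF.tendsto_logTan_atTop hP)).abs⟩⟩

/-! ### The wall at the base point, and uniform closeness to it -/

theorem logTan_base (hF : IsProfileFamily P₀ σ R U Z) (ξ : ℝ) : logTan Z P₀ ξ = σ * ξ := by
  have hσ : σ ≠ 0 := (hF.pos.trans hF.lt).ne'
  have : position Z P₀ (σ * ξ) = ξ := by
    simp only [position, hF.base, Complex.ofReal_re, intervalIntegral.integral_const, smul_eq_mul,
      sub_zero]
    field_simp
  conv_lhs => rw [← this]
  exact hF.logTan_position hF.mem _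

theorem wallAzimuth_base (hF : IsProfileFamily P₀ σ R U Z) (ξ : ℝ) : wallAzimuth Z P₀ ξ = 0 := by
  simp [wallAzimuth, azimuth, hF.base]

theorem logTan_zero (hF : IsProfileFamily P₀ σ R U Z) (hP : P ∈ U) : logTan Z P 0 = 0 := by
  have : position Z P 0 = 0 := by simp [position]
  conv_lhs => rw [← this]
  exact hF.logTan_position hP _

end IsProfileFamily

theorem abs_mul_sin_angle_le (v : ℝ) : |v| * Real.sin (angle v) ≤ 1 := by
  have h1 : |v| ≤ Real.cosh v := by
    rw [← Real.cosh_abs]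
    exact (Real.self_le_sinh_iff.2 (abs_nonneg v)).trans (Real.sinh_lt_cosh _).le
  have h2 : Real.sin (angle v) = (Real.cosh v)⁻¹ := by
    rw [sin_angle, Real.cosh_eq, Real.exp_neg]
    have := (Real.exp_pos v).ne'
    field_simp
    ring
  rw [h2, ← div_eq_mul_inv]
  exact (div_le_one (Real.cosh_pos v)).2 h1

/-- The error in `u` may grow linearly in `|ξ|`, but the derivative of `angle` at `v` is at most `1
/ |v|`. With `η ≤ σ / 2`, every `v` between the two arguments has `|v| ≥ σ |ξ| / 2`, and the factors
`|ξ|` cancel. -/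
theorem abs_angle_sub_le {σ η a ξ : ℝ} (hσ : 0 < σ) (hη0 : 0 ≤ η) (hη : η ≤ σ / 2)
    (ha : |a - σ * ξ| ≤ η * |ξ|) : |angle a - angle (σ * ξ)| ≤ 2 / σ * η := by
  rcases eq_or_ne ξ 0 with rfl | hξ
  · have h0 : a = 0 := by simpa using ha
    rw [h0, mul_zero, sub_self, abs_zero]
    positivity
  · have hξ' := abs_pos.2 hξ
    have hb : ∀ v ∈ Metric.closedBall (σ * ξ) (η * |ξ|), ‖Real.sin (angle v)‖ ≤ 2 / (σ * |ξ|) := by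
      intro v hv
      rw [Metric.mem_closedBall, Real.dist_eq] at hv
      have h1 : σ / 2 * |ξ| ≤ |v| := by
        have h2 := abs_sub_abs_le_abs_sub (σ * ξ) v
        rw [abs_sub_comm (σ * ξ) v, abs_mul, abs_of_pos hσ] at h2
        nlinarith
      rw [Real.norm_eq_abs, abs_of_pos (sin_angle_pos v), le_div_iff₀ (by positivity)]
      have := abs_mul_sin_angle_le v
      nlinarith [sin_angle_pos v]
    have := (convex_closedBall (σ * ξ) (η * |ξ|)).norm_image_sub_le_of_norm_hasDerivWithin_le
      (fun v _ => (hasDerivAt_angle v).hasDerivWithinAt) hb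
      (Metric.mem_closedBall_self (by positivity)) (show a ∈ _ from ha)
    rw [Real.norm_eq_abs, Real.norm_eq_abs] at this
    calc _ ≤ 2 / (σ * |ξ|) * |a - σ * ξ| := this
      _ ≤ 2 / (σ * |ξ|) * (η * |ξ|) := by gcongr
      _ = 2 / σ * η := by field_simp

theorem phaseCurve_base (μ ξ : ℝ) :
    phaseCurve (theta0 μ) phi0 ξ = (angle (Real.sqrt (-μ) * ξ), Real.sqrt (-μ), 0) := by
  have h : HasDerivAt (theta0 μ)
      (Real.sin (angle (Real.sqrt (-μ) * ξ)) * Real.sqrt (-μ)) ξ :=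
    ((hasDerivAt_angle _).comp ξ ((hasDerivAt_id ξ).const_mul (Real.sqrt (-μ)))).congr_deriv
      (by simp)
  have hs : Real.sin (theta0 μ ξ) = Real.sin (angle (Real.sqrt (-μ) * ξ)) := rfl
  have hφ : deriv phi0 ξ = 0 := by
    simp [show phi0 = fun _ => 0 from rfl]
  rw [phaseCurve, h.deriv, hφ, hs, mul_div_cancel_left₀ _ (sin_angle_pos _).ne']
  rfl

theorem IsProfileFamily.tendstoUniformly {P₀ : Param} {μ R : ℝ} {U : Set Param}
    {Z : Param → ℝ → ℂ} (hμ : μ < 0) (hF : IsProfileFamily P₀ (Real.sqrt (-μ)) R U Z) :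
    TendstoUniformly (fun P => phaseCurve (wallPolar Z P) (wallAzimuth Z P))
      (phaseCurve (theta0 μ) phi0) (𝓝 P₀) := by
  set σ := Real.sqrt (-μ) with hσdef
  have hσ : 0 < σ := Real.sqrt_pos.2 (by linarith)
  rw [Metric.tendstoUniformly_iff]
  intro ε hε
  set η : ℝ := min (σ / 2) (min (ε / 2) (ε * σ / 4)) with hη
  have hη0 : 0 < η := by positivity
  have hη1 : η ≤ σ / 2 := min_le_left _ _
  have hη2 : η ≤ ε / 2 := (min_le_right _ _).trans (min_le_left _ _)
  have hη3 : η ≤ ε * σ / 4 := (min_le_right _ _).trans (min_le_right _ _)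
  filter_upwards [hF.isOpen.mem_nhds hF.mem, hF.eventually_near η hη0] with P hP hnear ξ
  rw [phaseCurve_base, hF.phaseCurve_eq hP, dist_comm]
  have hre : ∀ u, |(Z P u).re - σ| ≤ η := fun u => by
    have := (Complex.abs_re_le_norm (Z P u - σ)).trans (hnear u)
    rwa [Complex.sub_re, Complex.ofReal_re] at this
  have him : ∀ u, |(Z P u).im| ≤ η := fun u => by
    have := (Complex.abs_im_le_norm (Z P u - σ)).trans (hnear u)
    rwa [Complex.sub_im, Complex.ofReal_im, sub_zero] at this
  have hY : |logTan Z P ξ - σ * ξ| ≤ η * |ξ| := by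
    have := (convex_univ (𝕜 := ℝ) (E := ℝ)).norm_image_sub_le_of_norm_hasDerivWithin_le
      (f := fun ξ => logTan Z P ξ - σ * ξ) (C := η) (x := 0) (y := ξ)
      (fun x _ => ((hF.hasDerivAt_logTan hP x).sub
        ((hasDerivAt_id x).const_mul σ)).hasDerivWithinAt)
      (fun x _ => by simpa using hre _) (mem_univ _) (mem_univ _)
    simpa [hF.logTan_zero hP] using this
  have hA := abs_angle_sub_le hσ hη0.le hη1 hY
  have hA' : 2 / σ * η < ε := by
    rw [div_mul_eq_mul_div, div_lt_iff₀ hσ]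
    nlinarith [mul_pos hε hσ]
  rw [Prod.dist_eq, Prod.dist_eq, Real.dist_eq, Real.dist_eq, Real.dist_eq, sub_zero]
  exact max_lt (hA.trans_lt hA') (max_lt ((hre _).trans_lt (by linarith))
    ((him _).trans_lt (by linarith)))

/-! ### Local uniqueness -/

/-- The bound on `p` keeps it above `σ - R > 0`, so `u = log tan (θ / 2)` is a bijective change of
variable and `z` as a function of `u` must be `Z P`. The autonomous equations `u' = p` and `φ' = q`
then leave only a shift `a` and a rotation `b`. -/
theorem IsProfileFamily.exists_eq_translate {P₀ : Param} {σ R : ℝ} {U : Set Param}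
    {Z : Param → ℝ → ℂ} (hF : IsProfileFamily P₀ σ R U Z) {c α β h μ s Ω : ℝ}
    (hP : (c, α, β, h, μ, s, Ω) ∈ U) {θ φ : ℝ → ℝ} (hw : IsDomainWall c α β h μ s Ω θ φ)
    (hp : ∀ ξ, |deriv θ ξ / Real.sin (θ ξ) - σ| ≤ R / 2) (hq : ∀ ξ, |deriv φ ξ| ≤ R / 2) :
    ∃ a b : ℝ, ∀ ξ, θ ξ = wallPolar Z (c, α, β, h, μ, s, Ω) (ξ + a) ∧
      φ ξ = wallAzimuth Z (c, α, β, h, μ, s, Ω) (ξ + a) + b := by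
  set P : Param := (c, α, β, h, μ, s, Ω) with hPdef
  have hS : ∀ ξ, 0 < Real.sin (θ ξ) := fun ξ => Real.sin_pos_of_mem_Ioo (hw.polar_mem ξ)
  have hdiff : ∀ f : ℝ → ℝ, ContDiff ℝ 2 f →
      (∀ ξ, HasDerivAt f (deriv f ξ) ξ) ∧ ∀ ξ, HasDerivAt (deriv f) (deriv (deriv f) ξ) ξ :=
    fun f hf => ⟨fun ξ => (hf.differentiable (by simp) ξ).hasDerivAt, fun ξ =>
      ((contDiff_succ_iff_deriv.1 (show ContDiff ℝ (1 + 1) f from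
        hf.of_le (by norm_num))).2.2.differentiable (by simp) ξ).hasDerivAt⟩
  obtain ⟨hθ, hθ'⟩ := hdiff θ hw.contDiff_polar
  obtain ⟨hφ, hφ'⟩ := hdiff φ hw.contDiff_azimuth
  set p : ℝ → ℝ := fun ξ => deriv θ ξ / Real.sin (θ ξ) with hpdef
  have hp' : ∀ ξ, HasDerivAt p (deriv p ξ) ξ := fun ξ =>
    ((hθ' ξ).div (hθ ξ).sin (hS ξ).ne').differentiableAt.hasDerivAt
  have hθp : ∀ ξ, HasDerivAt θ (p ξ * Real.sin (θ ξ)) ξ := fun ξ => by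
    rw [hpdef, div_mul_cancel₀ _ (hS ξ).ne']
    exact hθ ξ
  have heq := (eqn_iff_profile hθp hφ hp' hφ' fun ξ => (hS ξ).ne').1 hw.solves.eqn
  set z : ℝ → ℂ := fun ξ => p ξ + deriv φ ξ * Complex.I with hz
  have hzre : ∀ ξ, (z ξ).re = p ξ := fun ξ => by simp [hz]
  have hzim : ∀ ξ, (z ξ).im = deriv φ ξ := fun ξ => by simp [hz]
  set u : ℝ → ℝ := fun ξ => Real.log (Real.tan (θ ξ / 2)) with hu
  have hθu : ∀ ξ, angle (u ξ) = θ ξ := fun ξ => angle_log_tan (hw.polar_mem ξ)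
  have hzd : ∀ ξ, HasDerivAt z (riccati P (Real.tanh (u ξ)) (z ξ)) ξ := fun ξ => by
    have h1 := (hp' ξ).ofReal_comp.add ((hφ' ξ).ofReal_comp.mul_const Complex.I)
    rw [heq ξ, ← hθu ξ, cos_angle, neg_neg] at h1
    exact h1
  have hud : ∀ ξ, HasDerivAt u (p ξ) ξ := fun ξ => hasDerivAt_log_tan (hθ ξ) (hw.polar_mem ξ)
  have hRpos := hF.pos
  have hRlt := hF.lt
  have hple : ∀ ξ, σ - R ≤ p ξ := fun ξ => by linarith [(abs_le.1 (hp ξ)).1]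
  have hp0 : ∀ ξ, 0 < p ξ := fun ξ => (sub_pos.2 hRlt).trans_le (hple ξ)
  have hbij := bijective_of_le_deriv (sub_pos.2 hRlt) hud hple
  obtain ⟨v, hvu, huv⟩ := Function.bijective_iff_has_inverse.1 hbij
  have hvd : ∀ x, HasDerivAt v (p (v x))⁻¹ x := fun x =>
    HasDerivAt.of_local_left_inverse
      ((StrictMono.orderIsoOfRightInverse u (strictMono_of_hasDerivAt_pos hud hp0) v
        huv).symm.continuous.continuousAt)
      (hud (v x)) (hp0 _).ne' (Eventually.of_forall huv)
  have hζ : (fun x => z (v x)) = Z P := by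
    refine hF.unique P hP _ (fun x => ?_) fun x => ?_
    · have e : z (v x) - σ = ((p (v x) - σ : ℝ) : ℂ) + (deriv φ (v x) : ℝ) * Complex.I := by
        simp only [hz]
        push_cast
        ring
      rw [e]
      refine (norm_add_le _ _).trans ?_
      rw [norm_mul, Complex.norm_I, mul_one, Complex.norm_real, Complex.norm_real]
      exact (add_le_add (hp _) (hq _)).trans (by linarith)
    · have h1 := (hzd (v x)).scomp x (hvd x)
      rw [huv x] at h1
      refine h1.congr_deriv ?_
      rw [slope, hzre, Complex.real_smul, Complex.ofReal_inv]
  have hzZ : ∀ ξ, Z P (u ξ) = z ξ := fun ξ => by rw [← hζ]; exact congrArg z (hvu ξ)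
  have hpos : ∀ ξ, position Z P (u ξ) = ξ + position Z P (u 0) := by
    have h1 : ∀ ξ, HasDerivAt (fun ξ => position Z P (u ξ) - ξ) 0 ξ := fun ξ => by
      refine (((hF.hasDerivAt_position hP (u ξ)).comp ξ (hud ξ)).sub
        (hasDerivAt_id ξ)).congr_deriv ?_
      rw [hzZ, hzre, inv_mul_cancel₀ (hp0 ξ).ne', sub_self]
    intro ξ
    have := is_const_of_deriv_eq_zero (fun ξ => (h1 ξ).differentiableAt) (fun ξ => (h1 ξ).deriv) ξ 0
    simp only [sub_zero] at this
    linarith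
  set a := position Z P (u 0) with ha
  have hY : ∀ ξ, logTan Z P (ξ + a) = u ξ := fun ξ => by
    rw [← hpos ξ, hF.logTan_position hP]
  have hΦ : ∀ ξ, HasDerivAt (fun ξ => φ ξ - wallAzimuth Z P (ξ + a)) 0 ξ := fun ξ => by
    refine ((hφ ξ).sub ((hF.hasDerivAt_wallAzimuth hP (ξ + a)).comp_add_const ξ a)).congr_deriv ?_
    rw [hY, hzZ, hzim, sub_self]
  refine ⟨a, φ 0 - wallAzimuth Z P (0 + a), fun ξ => ⟨?_, ?_⟩⟩
  · rw [wallPolar, hY, hθu]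
  · have := is_const_of_deriv_eq_zero (fun ξ => (hΦ ξ).differentiableAt) (fun ξ => (hΦ ξ).deriv) ξ 0
    linarith

/-! ### Inhomogeneity -/

/-- The identity is polynomial in `t`, so it extends from `(-1, 1)` to the whole line. -/
theorem polar_current_eq_zero {A β c s μ a d : ℝ} (hc : |c| < 1)
    (h : ∀ t ∈ Ioo (-1 : ℝ) 1, -β * c * (1 - t ^ 2) * (A * (1 - c * t) - β) =
      t * ((A * (1 - c * t) - β) ^ 2 * (1 - c * t) + μ * s ^ 2 * (1 - c * t) ^ 3) -
        a * (1 - c * t) ^ 2 * (A * (1 - c * t) - β) + d * (1 - c * t) ^ 3) : β * c = 0 := by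
  by_contra hne
  have hc0 : c ≠ 0 := right_ne_zero_of_mul hne
  have hβ0 : β ≠ 0 := left_ne_zero_of_mul hne
  let y : Polynomial ℝ := 1 - Polynomial.C c * Polynomial.X
  let B : Polynomial ℝ := Polynomial.C A * y - Polynomial.C β
  let Q : Polynomial ℝ := Polynomial.C (-β * c) * (1 - Polynomial.X ^ 2) * B -
    (Polynomial.X * (B ^ 2 * y + Polynomial.C (μ * s ^ 2) * y ^ 3) -
      Polynomial.C a * y ^ 2 * B + Polynomial.C d * y ^ 3)
  have hev : ∀ t, Q.eval t = -β * c * (1 - t ^ 2) * (A * (1 - c * t) - β) -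
      (t * ((A * (1 - c * t) - β) ^ 2 * (1 - c * t) + μ * s ^ 2 * (1 - c * t) ^ 3) -
        a * (1 - c * t) ^ 2 * (A * (1 - c * t) - β) + d * (1 - c * t) ^ 3) := fun t => by
    simp [Q, B, y]
  have hQ : Q = 0 := Polynomial.eq_zero_of_infinite_isRoot Q
    ((Ioo_infinite (show (-1 : ℝ) < 1 by norm_num)).mono fun t ht => by
      change Q.eval t = 0
      rw [hev, h t ht, sub_self])
  -- At `t = 1 / c` the factor `1 - c t` vanishes, leaving `β² c (1 - c⁻²) = 0`, impossible for `|c|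
  -- < 1` and `β c ≠ 0`.
  have h1 := hev c⁻¹
  rw [hQ, Polynomial.eval_zero, mul_inv_cancel₀ hc0] at h1
  have h2 : β ^ 2 * c * (1 - c⁻¹ ^ 2) = 0 := by linear_combination -h1
  have h3 : (1 - c⁻¹ ^ 2) = 0 := by simpa [hβ0, hc0] using h2
  have h4 : c ^ 2 = 1 := by
    field_simp at h3
    linarith
  have := (sq_lt_one_iff_abs_lt_one c).2 hc
  linarith

theorem hasDerivAt_tanh (u : ℝ) : HasDerivAt Real.tanh (1 - Real.tanh u ^ 2) u := by
  have h : Real.tanh = fun x => Real.sinh x / Real.cosh x := funext Real.tanh_eq_sinh_div_cosh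
  rw [h]
  have hc := (Real.cosh_pos u).ne'
  refine ((Real.hasDerivAt_sinh u).div (Real.hasDerivAt_cosh u) hc).congr_deriv ?_
  field_simp

theorem IsProfileFamily.eq_of_isHomogeneous {P₀ : Param} {σ R : ℝ} {U : Set Param}
    {Z : Param → ℝ → ℂ} (hF : IsProfileFamily P₀ σ R U Z) {c α β h μ s Ω : ℝ} (hμ : μ < 0)
    (hs : 0 < s) (hP : (c, α, β, h, μ, s, Ω) ∈ U)
    (hom : IsHomogeneous (wallAzimuth Z (c, α, β, h, μ, s, Ω))) :
    β * c = 0 ∧ s = speed0 α β h μ ∧ Ω = freq0 α β h := by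
  set P : Param := (c, α, β, h, μ, s, Ω) with hPdef
  have hc : |c| < 1 := hF.abs_lt P hP
  have him : ∀ u, (Z P u).im = 0 := fun u => by
    have := hom (position Z P u)
    rw [hF.deriv_wallAzimuth hP] at this
    change (Z P (logTan Z P (position Z P u))).im = 0 at this
    rwa [hF.logTan_position hP] at this
  have hZ : ∀ u, Z P u = (Z P u).re + (0 : ℝ) * Complex.I := fun u => by
    rw [← him u]
    exact (Complex.re_add_im _).symm
  set p : ℝ → ℝ := fun u => (Z P u).re with hp
  have hp0 : ∀ u, 0 < p u := hF.re_pos hP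
  have hy : ∀ u, 0 < 1 - c * Real.tanh u := fun u => by
    have : |c * Real.tanh u| < 1 := by
      rw [abs_mul]
      exact (mul_le_of_le_one_right (abs_nonneg _) (Real.abs_tanh_lt_one u).le).trans_lt hc
    linarith [(_root_.abs_lt.1 this).2]
  have hslope : ∀ u, slope P (Real.tanh u) (Z P u) = ((p u)⁻¹ : ℝ) *
      riccati P (Real.tanh u) (p u + (0 : ℝ) * Complex.I) := fun u => by
    rw [slope, Complex.ofReal_inv, ← hZ u]
  have hpd : ∀ u, HasDerivAt p
      ((p u)⁻¹ * (Real.tanh u * (p u ^ 2 + μ) - α * s * p u + h - Ω)) u := fun u => by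
    refine (Complex.reCLM.hasFDerivAt.comp_hasDerivAt u (hF.hasDerivAt P hP u)).congr_deriv ?_
    rw [Complex.reCLM_apply, hslope, Complex.re_ofReal_mul, riccati_re]
    ring
  have halg : ∀ u, s * p u * (1 - c * Real.tanh u) =
      α * Ω * (1 - c * Real.tanh u) - β := fun u => by
    have h1 : HasDerivAt (fun u => (Z P u).im) (slope P (Real.tanh u) (Z P u)).im u :=
      Complex.imCLM.hasFDerivAt.comp_hasDerivAt u (hF.hasDerivAt P hP u)
    have h2 : HasDerivAt (fun u => (Z P u).im) 0 u := by
      rw [show (fun u => (Z P u).im) = fun _ => 0 from funext him]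
      exact hasDerivAt_const u 0
    have h3 := h1.unique h2
    rw [hslope, Complex.im_ofReal_mul, riccati_im, mul_eq_zero] at h3
    have h4 := h3.resolve_left (inv_pos.2 (hp0 u)).ne'
    have h5 := (div_eq_iff (hy u).ne').1
      (show β / (1 - c * Real.tanh u) = α * Ω - s * p u by linarith)
    linear_combination h5
  -- Differentiating `halg` and inserting the equation for `p` gives a second relation; eliminating
  -- `p` leaves an identity in `t = tanh u` alone.
  have hder : ∀ u, s * ((p u)⁻¹ * (Real.tanh u * (p u ^ 2 + μ) - α * s * p u + h - Ω)) *
      (1 - c * Real.tanh u) - s * p u * (c * (1 - Real.tanh u ^ 2)) =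
      -(α * Ω * (c * (1 - Real.tanh u ^ 2))) := fun u => by
    have hyd : HasDerivAt (fun u => 1 - c * Real.tanh u) (-(c * (1 - Real.tanh u ^ 2))) u :=
      ((hasDerivAt_tanh u).const_mul c).const_sub 1
    have h1 := ((hpd u).const_mul s).mul hyd
    have h2 := (hyd.const_mul (α * Ω)).sub_const β
    have h3 : (fun u => s * p u * (1 - c * Real.tanh u)) =
        fun u => α * Ω * (1 - c * Real.tanh u) - β := funext halg
    have h4 := HasDerivAt.unique (f := fun u => s * p u * (1 - c * Real.tanh u)) h1 (h3 ▸ h2)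
    linear_combination h4
  have hβc : β * c = 0 := by
    refine polar_current_eq_zero (A := α * Ω) (s := s) (μ := μ) (a := α * s ^ 2)
      (d := (h - Ω) * s ^ 2) hc fun t ht => ?_
    obtain ⟨u, -, rfl⟩ := Real.tanh_surjOn ht
    have h1 := halg u
    have h2 := hder u
    have h3 := (hp0 u).ne'
    have h4 : s * (Real.tanh u * (p u ^ 2 + μ) - α * s * p u + h - Ω) * (1 - c * Real.tanh u) =
        p u * (c * (1 - Real.tanh u ^ 2)) * (s * p u - α * Ω) := by
      field_simp at h2
      linear_combination h2
    rw [← h1]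
    linear_combination -s * (1 - c * Real.tanh u) ^ 2 * h4 -
      c * (1 - Real.tanh u ^ 2) * s * p u * (1 - c * Real.tanh u) * h1
  have hdiv : ∀ u, s * p u = α * Ω - β := fun u => by
    rcases mul_eq_zero.1 hβc with h0 | h0
    · have := halg u
      rw [h0, sub_zero] at this ⊢
      exact mul_right_cancel₀ (hy u).ne' this
    · simpa [h0] using halg u
  have hconst : ∀ u, p u = (α * Ω - β) / s := fun u => by
    rw [← hdiv u, mul_div_cancel_left₀ _ hs.ne']
  set p₀ := (α * Ω - β) / s with hp₀
  have hp₀pos : 0 < p₀ := hconst 0 ▸ hp0 0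
  have hre : ∀ t ∈ Ioo (-1 : ℝ) 1, t * (p₀ ^ 2 + μ) - α * s * p₀ + h - Ω = 0 := fun t ht => by
    obtain ⟨u, -, rfl⟩ := Real.tanh_surjOn ht
    have h1 := hpd u
    rw [show p = fun _ => p₀ from funext hconst] at h1
    have h2 := h1.unique (hasDerivAt_const u p₀)
    exact (mul_eq_zero.1 h2).resolve_left (inv_pos.2 hp₀pos).ne'
  -- An affine function of `t` vanishing at two points has zero slope, so `p₀² = -μ`, and zero
  -- constant term; the latter and `hsp` are two linear equations that determine `Ω` and `s`.
  have e0 := hre 0 (by norm_num)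
  have e1 := hre (1 / 2) (by norm_num)
  have hsq : p₀ = Real.sqrt (-μ) := by
    refine ((Real.sqrt_eq_iff_mul_self_eq (by linarith) hp₀pos.le).2 ?_).symm
    linarith
  have hsp : s * p₀ = α * Ω - β := by rw [← hconst 0]; exact hdiv 0
  have hden : 1 + α ^ 2 ≠ 0 := by positivity
  have hΩ : Ω = freq0 α β h := by
    rw [freq0, eq_div_iff hden]
    linear_combination -α * hsp - e0
  refine ⟨hβc, ?_, hΩ⟩
  have hsqpos : Real.sqrt (-μ) ≠ 0 := hsq ▸ hp₀pos.ne'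
  rw [speed0, eq_div_iff (mul_ne_zero hsqpos hden), ← hsq]
  rw [freq0, eq_div_iff hden] at hΩ
  linear_combination (1 + α ^ 2) * hsp + α * hΩ

/-! ### The base parameters -/

/-- The codim-0 condition multiplied by `α²`: this is the strict decay of the linearization at `t =
1`, the worst case. -/
theorem two_mul_sqrt_lt {α β h μ : ℝ} (hα : 0 < α) (hμ : μ < 0)
    (hh : β / α - 2 * μ - 2 * μ / α ^ 2 < h) : 2 * Real.sqrt (-μ) < α * speed0 α β h μ := by
  have hσ : 0 < Real.sqrt (-μ) := Real.sqrt_pos.2 (by linarith)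
  have hsq : Real.sqrt (-μ) * Real.sqrt (-μ) = -μ := Real.mul_self_sqrt (by linarith)
  have h1 : -2 * μ * (1 + α ^ 2) < α * (α * h - β) := by
    have := mul_lt_mul_of_pos_left hh (by positivity : 0 < α ^ 2)
    have e : α ^ 2 * (β / α - 2 * μ - 2 * μ / α ^ 2) = α * β - 2 * μ * (1 + α ^ 2) := by
      field_simp
      ring
    rw [e] at this
    linarith
  rw [speed0, mul_div_assoc', lt_div_iff₀ (by positivity)]
  nlinarith

/-- At `c = 0` the dependence on `t` enters only through `t (σ² + μ) = 0`; `speed0` and `freq0`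
solve the two remaining real equations. -/
theorem riccati_base {α β h μ : ℝ} (hμ : μ < 0) (t : ℝ) :
    riccati (0, α, β, h, μ, speed0 α β h μ, freq0 α β h) t (Real.sqrt (-μ) : ℝ) = 0 := by
  have hσ : Real.sqrt (-μ) ≠ 0 := (Real.sqrt_pos.2 (by linarith)).ne'
  have hsq : Real.sqrt (-μ) ^ 2 = -μ := Real.sq_sqrt (by linarith)
  have hden : 1 + α ^ 2 ≠ 0 := by positivity
  have h1 := riccati_eq 0 α β h μ (speed0 α β h μ) (freq0 α β h) t (Real.sqrt (-μ)) 0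
  have hs : speed0 α β h μ * Real.sqrt (-μ) = (α * h - β) / (1 + α ^ 2) := by
    rw [speed0]
    field_simp
  have e1 : t * (Real.sqrt (-μ) ^ 2 - 0 ^ 2 + μ) - α * speed0 α β h μ * Real.sqrt (-μ) +
      speed0 α β h μ * 0 + h - freq0 α β h = 0 := by
    rw [hsq, mul_assoc α, hs, freq0]
    field_simp
    ring
  have e2 : 2 * t * Real.sqrt (-μ) * 0 - α * speed0 α β h μ * 0 -
      speed0 α β h μ * Real.sqrt (-μ) - β / (1 - 0 * t) + α * freq0 α β h = 0 := by
    rw [hs, freq0]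
    field_simp
    ring
  rw [e1, e2] at h1
  simpa using h1

end LLGS

end

/-! ### Assembly of the theorem. -/

theorem theorem1 (α₀ β₀ h₀ μ₀ : ℝ) (hα : 0 < α₀) (hβ : 0 ≤ β₀) (hμ : μ₀ < 0)
    (hh : β₀ / α₀ - 2 * μ₀ - 2 * μ₀ / α₀ ^ 2 < h₀) :
    ∃ (U : Set LLGS.Param) (Θ Φ : LLGS.Param → ℝ → ℝ) (ε : ℝ),
      IsOpen U ∧
      (0, α₀, β₀, h₀, μ₀, LLGS.speed0 α₀ β₀ h₀ μ₀, LLGS.freq0 α₀ β₀ h₀) ∈ U ∧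
      (∀ c α β h μ s Ω : ℝ, (c, α, β, h, μ, s, Ω) ∈ U → |c| < 1 ∧ 0 < α ∧ μ < 0) ∧
      -- each member of the family is a flat domain wall
      (∀ c α β h μ s Ω : ℝ, (c, α, β, h, μ, s, Ω) ∈ U →
        LLGS.IsDomainWall c α β h μ s Ω
          (Θ (c, α, β, h, μ, s, Ω)) (Φ (c, α, β, h, μ, s, Ω)) ∧
        LLGS.IsFlat (Φ (c, α, β, h, μ, s, Ω))) ∧
      -- the family is smooth in all parameters and the space variable
      ContDiffOn ℝ ∞ (fun z : LLGS.Param × ℝ => Θ z.1 z.2) (U ×ˢ univ) ∧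
      ContDiffOn ℝ ∞ (fun z : LLGS.Param × ℝ => Φ z.1 z.2) (U ×ˢ univ) ∧
      -- it contains the explicit homogeneous wall and stays uniformly close to it nearby
      Θ (0, α₀, β₀, h₀, μ₀, LLGS.speed0 α₀ β₀ h₀ μ₀, LLGS.freq0 α₀ β₀ h₀) = LLGS.theta0 μ₀ ∧
      Φ (0, α₀, β₀, h₀, μ₀, LLGS.speed0 α₀ β₀ h₀ μ₀, LLGS.freq0 α₀ β₀ h₀) = LLGS.phi0 ∧
      TendstoUniformly (fun P : LLGS.Param => LLGS.phaseCurve (Θ P) (Φ P))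
        (LLGS.phaseCurve (LLGS.theta0 μ₀) LLGS.phi0)
        (𝓝 (0, α₀, β₀, h₀, μ₀, LLGS.speed0 α₀ β₀ h₀ μ₀, LLGS.freq0 α₀ β₀ h₀)) ∧
      -- local uniqueness, up to translations and rotations
      0 < ε ∧
      (∀ c α β h μ s Ω : ℝ, (c, α, β, h, μ, s, Ω) ∈ U →
        ∀ θ φ : ℝ → ℝ, LLGS.IsDomainWall c α β h μ s Ω θ φ →
          (∀ ξ, ∃ η, dist (LLGS.phaseCurve θ φ ξ)
            (LLGS.phaseCurve (LLGS.theta0 μ₀) LLGS.phi0 η) < ε) →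
          ∃ a b : ℝ, ∀ ξ,
            θ ξ = Θ (c, α, β, h, μ, s, Ω) (ξ + a) ∧
            φ ξ = Φ (c, α, β, h, μ, s, Ω) (ξ + a) + b) ∧
      -- inhomogeneity
      (∀ c α β h μ s Ω : ℝ, (c, α, β, h, μ, s, Ω) ∈ U →
        (β * c ≠ 0 ∨ (s, Ω) ≠ (LLGS.speed0 α β h μ, LLGS.freq0 α β h)) →
        ¬ LLGS.IsHomogeneous (Φ (c, α, β, h, μ, s, Ω))) := by
  have hσ : 0 < Real.sqrt (-μ₀) := Real.sqrt_pos.2 (by linarith)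
  have hs := LLGS.two_mul_sqrt_lt hα hμ hh
  have hs₀ : 0 < LLGS.speed0 α₀ β₀ h₀ μ₀ := by
    by_contra hneg
    nlinarith
  obtain ⟨R, U, Z, hF⟩ := LLGS.exists_isProfileFamily
    (P₀ := (0, α₀, β₀, h₀, μ₀, LLGS.speed0 α₀ β₀ h₀ μ₀, LLGS.freq0 α₀ β₀ h₀)) hσ (by simp) hs
    (LLGS.riccati_base hμ)
  -- Besides the required signs of `α` and `μ`, the neighbourhood is shrunk to `s > 0`, since the
  -- inhomogeneity argument divides by `s`.
  have hG := hF.mono (V := U ∩ ({P : LLGS.Param | 0 < P.2.1} ∩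
    ({P : LLGS.Param | P.2.2.2.2.1 < 0} ∩ {P : LLGS.Param | 0 < P.2.2.2.2.2.1})))
    (hF.isOpen.inter ((isOpen_lt continuous_const (by fun_prop)).inter
      ((isOpen_lt (by fun_prop) continuous_const).inter
        (isOpen_lt continuous_const (by fun_prop))))) inter_subset_left
    ⟨hF.mem, hα, hμ, hs₀⟩
  have hR := hF.pos
  -- With `ε = R / 2`, both `|p - σ|` and `|q|` are below `R / 2`, so `z` lies in the ball of radius
  -- `R` where the bounded solution is unique.
  refine ⟨_, LLGS.wallPolar Z, LLGS.wallAzimuth Z, R / 2, hG.isOpen, hG.mem,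
    fun c α β h μ s Ω hP => ⟨hG.abs_lt _ hP, hP.2.1, hP.2.2.1⟩,
    fun c α β h μ s Ω hP => ⟨hG.isDomainWall hP, hG.isFlat hP⟩,
    hG.contDiffOn_wallPolar, hG.contDiffOn_wallAzimuth, ?_, ?_, hG.tendstoUniformly hμ,
    by positivity, ?_, ?_⟩
  · ext ξ
    rw [LLGS.wallPolar, hG.logTan_base]
    rfl
  · ext ξ
    exact hG.wallAzimuth_base ξ
  · intro c α β h μ s Ω hP θ φ hw hnear
    have hd : ∀ ξ, |deriv θ ξ / Real.sin (θ ξ) - Real.sqrt (-μ₀)| < R / 2 ∧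
        |deriv φ ξ| < R / 2 := fun ξ => by
      obtain ⟨η, hη⟩ := hnear ξ
      rw [LLGS.phaseCurve_base, LLGS.phaseCurve, Prod.dist_eq, Prod.dist_eq, max_lt_iff,
        max_lt_iff, Real.dist_eq, Real.dist_eq, Real.dist_eq, sub_zero] at hη
      exact hη.2
    exact hG.exists_eq_translate hP hw (fun ξ => (hd ξ).1.le) fun ξ => (hd ξ).2.le
  · intro c α β h μ s Ω hP hne hom
    obtain ⟨h1, h2, h3⟩ := hG.eq_of_isHomogeneous hP.2.2.1 hP.2.2.2 hP hom
    rcases hne with hne | hne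
    · exact hne h1
    · exact hne (Prod.ext h2 h3)
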